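/- There is a combinatorial model category structure on the category $\mathbf{Cat}$ of small categories and functors in which a functor $F : A \to B$ is 1. a cofibration if and only if it is injective on objects; 2. a weak equivalence if and only if, for every small groupoid $Z$, the precomposition functor $[F, Z] : [B, Z] \to [A, Z]$ between functor categories is an equivalence of categories; 3. a fibration if and only if it has the right lifting property with respect to all functors that satisfy both (1) and (2). The fibrant objects of this model structure are exactly the groupoids. Here a model category is called combinatorial if its underlying category is locally presentable and its model structure is cofibrantly generated. -/

import Mathlib

open CategoryTheory CategoryTheory.Limits HomotopicalAlgebra

universe w v u

/-- The functors between small categories which are injective on objects. -/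
def injectiveOnObjects : MorphismProperty Cat.{u, u} :=
  fun _ _ F => Function.Injective F.toFunctor.obj

/-- The functors `F : A ⥤ B` between small categories such that, for every small groupoid `Z`,
the precomposition functor `[F, Z] : [B, Z] ⥤ [A, Z]` is an equivalence of categories. -/
def groupoidalEquivalences : MorphismProperty Cat.{u, u} :=
  fun A B F => ∀ (Z : Type u) [Groupoid.{u} Z],
    ((Functor.whiskeringLeft A B Z).obj F.toFunctor).IsEquivalence

/-- A model category is combinatorial if its underlying category is locally presentable and
the model structure is cofibrantly generated: there are a set `I` of generating cofibrations
and a set `J` of generating trivial cofibrations, both permitting the small object argument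
(in particular both `w`-small), which detect the trivial fibrations and the fibrations. -/
structure IsCombinatorialModelCategory (C : Type u) [Category.{v} C] [ModelCategory C] :
    Prop where
  isLocallyPresentable : IsLocallyPresentable.{w} C
  exists_generatingCofibrations : ∃ I : MorphismProperty C,
    MorphismProperty.HasSmallObjectArgument.{w} I ∧ trivialFibrations C = I.rlp
  exists_generatingTrivialCofibrations : ∃ J : MorphismProperty C,
    MorphismProperty.HasSmallObjectArgument.{w} J ∧ fibrations C = J.rlp

/-! Write I for the functors injective on objects, W for the groupoidal equivalences and S for the
fully faithful functors surjective on objects. A cylinder factorization gives the weak factorization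
system (I, S), and S ⊆ W. What remains is a weak factorization system with left class I ∩ W whose
right class meets W exactly in S (`rlp_inf_groupoidalEquivalences`).

Let J consist of representatives of the functors in I ∩ W between countable categories. Since `Cat`
is locally presentable, the small object argument factors every functor through J.rlp.llp and J.rlp.
The class I ∩ W is detected by lifting against S, against Z → pt and against Arrow Z → Z × Z for
groupoids Z (`groupoidalEquivalences_of_lifting`), so J.rlp.llp ⊆ I ∩ W. By the retract argument,
the converse follows from the crux J.rlp ∩ W ⊆ S
(`surjectiveEquivalences_of_countableGenerators_rlp`).

Let p : E ⟶ B lie in J.rlp ∩ W. If p identifies two parallel morphisms, so does every functor from E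
to a groupoid. This is already forced in a countable subcategory (`exists_countable_of_map_eq`), and
identifying the two morphisms there is a map of the type in J; lifting against it shows that they
are equal. For fullness and surjectivity, lifting against an endpoint of [1] and against a cospan or
a span in [2] turns the objects of the fibres, modulo vertical morphisms, into a local system on B.
The class of e is a section over E, which extends to B because p ∈ W. Its values give preimages of
objects and its compatibility with morphisms gives fullness.

For the fibrant objects, the localization of C at all morphisms is in I ∩ W, so a fibrant C is a
retract of it, hence a groupoid. Conversely, functors to a groupoid extend strictly along I ∩ W
(`exists_extension`). -/

/-! ### Filtered colimits of categories -/

namespace FilteredColimitCat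

variable {J : Type u} [SmallCategory J] (F : J ⥤ Cat.{u, u})

/-- The transition functors of a diagram of categories. -/
abbrev tr {i j : J} (φ : i ⟶ j) : F.obj i ⥤ F.obj j := (F.map φ).toFunctor

lemma tr_comp {i j k : J} (φ : i ⟶ j) (ψ : j ⟶ k) : tr F (φ ≫ ψ) = tr F φ ⋙ tr F ψ := by
  simp [tr]

lemma tr_comp_mapArrow {i j k : J} (φ : i ⟶ j) (ψ : j ⟶ k) (f : Arrow (F.obj i)) :
    (tr F (φ ≫ ψ)).mapArrow.obj f = (tr F ψ).mapArrow.obj ((tr F φ).mapArrow.obj f) := by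
  rw [tr_comp]; rfl

/-- Two objects in a diagram of categories are identified at a later stage. -/
def objRel (x y : Σ j, F.obj j) : Prop :=
  ∃ (k : J) (φ : x.1 ⟶ k) (ψ : y.1 ⟶ k), (tr F φ).obj x.2 = (tr F ψ).obj y.2

/-- Two arrows in a diagram of categories are identified at a later stage. -/
def arrRel (x y : Σ j, Arrow (F.obj j)) : Prop :=
  ∃ (k : J) (φ : x.1 ⟶ k) (ψ : y.1 ⟶ k),
    (tr F φ).mapArrow.obj x.2 = (tr F ψ).mapArrow.obj y.2

/-- The set of objects of the filtered colimit. -/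
def Obj : Type u := Quot (objRel F)

/-- The set of arrows of the filtered colimit. -/
def Arr : Type u := Quot (arrRel F)

/-- The class of an object. -/
def mkObj {j : J} (x : F.obj j) : Obj F := Quot.mk _ ⟨j, x⟩

/-- The class of an arrow. -/
def mkArr {j : J} (f : Arrow (F.obj j)) : Arr F := Quot.mk _ ⟨j, f⟩

lemma exists_mkObj (x : Obj F) : ∃ (j : J) (a : F.obj j), mkObj F a = x := by
  obtain ⟨j, a⟩ := x
  exact ⟨j, a, rfl⟩

lemma exists_mkArr (x : Arr F) : ∃ (j : J) (a : Arrow (F.obj j)), mkArr F a = x := by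
  obtain ⟨j, a⟩ := x
  exact ⟨j, a, rfl⟩

lemma mkObj_tr {i j : J} (φ : i ⟶ j) (x : F.obj i) : mkObj F ((tr F φ).obj x) = mkObj F x :=
  Quot.sound ⟨j, 𝟙 j, φ, by simp [tr]⟩

lemma mkArr_tr {i j : J} (φ : i ⟶ j) (f : Arrow (F.obj i)) :
    mkArr F ((tr F φ).mapArrow.obj f) = mkArr F f :=
  Quot.sound ⟨j, 𝟙 j, φ, by rw [← tr_comp_mapArrow, Category.comp_id]⟩

/-- The source of an arrow. -/
def src : Arr F → Obj F :=
  Quot.lift (fun x ↦ mkObj F x.2.left) (by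
    rintro ⟨i, f⟩ ⟨j, g⟩ ⟨k, φ, ψ, h⟩
    exact Quot.sound ⟨k, φ, ψ, congr_arg Arrow.leftFunc.obj h⟩)

/-- The target of an arrow. -/
def tgt : Arr F → Obj F :=
  Quot.lift (fun x ↦ mkObj F x.2.right) (by
    rintro ⟨i, f⟩ ⟨j, g⟩ ⟨k, φ, ψ, h⟩
    exact Quot.sound ⟨k, φ, ψ, congr_arg Arrow.rightFunc.obj h⟩)

/-- The identity of an object. -/
def idArr : Obj F → Arr F :=
  Quot.lift (fun x ↦ mkArr F (Arrow.mk (𝟙 x.2))) (by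
    rintro ⟨i, x⟩ ⟨j, y⟩ ⟨k, φ, ψ, h⟩
    dsimp only at φ ψ h ⊢
    have h' : ∀ (a b : F.obj k), a = b → mkArr F (Arrow.mk (𝟙 a)) = mkArr F (Arrow.mk (𝟙 b)) := by
      rintro _ _ rfl; rfl
    rw [← mkArr_tr F φ, ← mkArr_tr F ψ]
    simp only [Functor.mapArrow_obj, Arrow.mk_left, Arrow.mk_right, Arrow.mk_hom]
    simpa only [← CategoryTheory.Functor.map_id] using h' _ _ h)

lemma w_toFunctor {F : J ⥤ Cat.{u, u}} (s : Cocone F) {i j : J} (φ : i ⟶ j) :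
    tr F φ ⋙ (s.ι.app j).toFunctor = (s.ι.app i).toFunctor :=
  congr_arg Cat.Hom.toFunctor (s.w φ)

section

variable {F} (s : Cocone F)

/-- The map on objects induced by a cocone. -/
def descObj : Obj F → s.pt :=
  Quot.lift (fun x ↦ (s.ι.app x.1).toFunctor.obj x.2) (by
    rintro ⟨i, x⟩ ⟨j, y⟩ ⟨k, φ, ψ, h⟩
    dsimp only at φ ψ h ⊢
    rw [← w_toFunctor s φ, ← w_toFunctor s ψ]
    exact congr_arg (s.ι.app k).toFunctor.obj h)

/-- The map on arrows induced by a cocone. -/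
def descArr : Arr F → Arrow s.pt :=
  Quot.lift (fun x ↦ (s.ι.app x.1).toFunctor.mapArrow.obj x.2) (by
    rintro ⟨i, x⟩ ⟨j, y⟩ ⟨k, φ, ψ, h⟩
    dsimp only at φ ψ h ⊢
    rw [← w_toFunctor s φ, ← w_toFunctor s ψ]
    exact congr_arg (s.ι.app k).toFunctor.mapArrow.obj h)

lemma descArr_left (f : Arr F) : (descArr s f).left = descObj s (src F f) := by
  obtain ⟨j, f, rfl⟩ := exists_mkArr F f; rfl

lemma descArr_right (f : Arr F) : (descArr s f).right = descObj s (tgt F f) := by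
  obtain ⟨j, f, rfl⟩ := exists_mkArr F f; rfl

end

variable [IsFiltered J]

lemma objRel_equivalence : _root_.Equivalence (objRel F) where
  refl x := ⟨x.1, 𝟙 _, 𝟙 _, rfl⟩
  symm := by rintro x y ⟨k, φ, ψ, h⟩; exact ⟨k, ψ, φ, h.symm⟩
  trans := by
    rintro ⟨i, x⟩ ⟨j, y⟩ ⟨l, z⟩ ⟨k, φ, ψ, h⟩ ⟨k', φ', ψ', h'⟩
    obtain ⟨m, a, b, hab⟩ := IsFiltered.span ψ φ'
    refine ⟨m, φ ≫ a, ψ' ≫ b, ?_⟩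
    have e₁ := congr_arg (tr F a).obj h
    have e₂ := congr_arg (tr F b).obj h'
    have e₃ := congr_arg (fun θ ↦ (tr F θ).obj y) hab
    simp only [tr_comp, Functor.comp_obj] at e₁ e₂ e₃ ⊢
    rw [e₁, e₃, e₂]

lemma arrRel_equivalence : _root_.Equivalence (arrRel F) where
  refl x := ⟨x.1, 𝟙 _, 𝟙 _, rfl⟩
  symm := by rintro x y ⟨k, φ, ψ, h⟩; exact ⟨k, ψ, φ, h.symm⟩
  trans := by
    rintro ⟨i, x⟩ ⟨j, y⟩ ⟨l, z⟩ ⟨k, φ, ψ, h⟩ ⟨k', φ', ψ', h'⟩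
    obtain ⟨m, a, b, hab⟩ := IsFiltered.span ψ φ'
    refine ⟨m, φ ≫ a, ψ' ≫ b, ?_⟩
    have e₁ := congr_arg (tr F a).mapArrow.obj h
    have e₂ := congr_arg (tr F b).mapArrow.obj h'
    have e₃ := congr_arg (fun θ ↦ (tr F θ).mapArrow.obj y) hab
    simp only [tr_comp_mapArrow] at e₁ e₂ e₃ ⊢
    rw [e₁, e₃, e₂]

lemma mkObj_eq_iff {i j : J} (x : F.obj i) (y : F.obj j) :
    mkObj F x = mkObj F y ↔ objRel F ⟨i, x⟩ ⟨j, y⟩ :=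
  (objRel_equivalence F).quot_mk_eq_iff _ _

lemma mkArr_eq_iff {i j : J} (x : Arrow (F.obj i)) (y : Arrow (F.obj j)) :
    mkArr F x = mkArr F y ↔ arrRel F ⟨i, x⟩ ⟨j, y⟩ :=
  (arrRel_equivalence F).quot_mk_eq_iff _ _

lemma exists_composable {C : Type u} [Category.{u} C] (p q : Arrow C) (h : p.right = q.left) :
    ∃ (a b c : C) (f : a ⟶ b) (g : b ⟶ c), p = Arrow.mk f ∧ q = Arrow.mk g := by
  obtain ⟨a, b, f⟩ := p
  obtain ⟨b', c, g⟩ := q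
  obtain rfl : b = b' := h
  exact ⟨a, b, c, f, g, rfl, rfl⟩

lemma arrow_mk_comp_congr {C : Type u} [Category.{u} C] {a b c a' b' c' : C}
    {f : a ⟶ b} {g : b ⟶ c} {f' : a' ⟶ b'} {g' : b' ⟶ c'}
    (hf : Arrow.mk f = Arrow.mk f') (hg : Arrow.mk g = Arrow.mk g') :
    Arrow.mk (f ≫ g) = Arrow.mk (f' ≫ g') := by
  cases hf
  cases hg
  rfl

/-- The middle objects agree at some later stage, and both arrows can be moved there. -/
lemma exists_rep₂ (p q : Arr F) (h : tgt F p = src F q) :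
    ∃ (j : J) (a b c : F.obj j) (f : a ⟶ b) (g : b ⟶ c),
      p = mkArr F (Arrow.mk f) ∧ q = mkArr F (Arrow.mk g) := by
  obtain ⟨i, p, rfl⟩ := exists_mkArr F p
  obtain ⟨j, q, rfl⟩ := exists_mkArr F q
  obtain ⟨k, φ, ψ, h⟩ := (mkObj_eq_iff F _ _).1 h
  obtain ⟨a, b, c, f, g, hf, hg⟩ :=
    exists_composable ((tr F φ).mapArrow.obj p) ((tr F ψ).mapArrow.obj q) h
  exact ⟨k, a, b, c, f, g, by rw [← hf, mkArr_tr], by rw [← hg, mkArr_tr]⟩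

lemma exists_rep₃ (p q r : Arr F) (h : tgt F p = src F q) (h' : tgt F q = src F r) :
    ∃ (j : J) (a b c d : F.obj j) (f : a ⟶ b) (g : b ⟶ c) (k : c ⟶ d),
      p = mkArr F (Arrow.mk f) ∧ q = mkArr F (Arrow.mk g) ∧ r = mkArr F (Arrow.mk k) := by
  obtain ⟨i, a, b, c, f, g, rfl, rfl⟩ := exists_rep₂ F p q h
  obtain ⟨j, r, rfl⟩ := exists_mkArr F r
  obtain ⟨k, φ, ψ, h⟩ := (mkObj_eq_iff F _ _).1 h'
  obtain ⟨c', c'', d, g', k', hg, hk⟩ :=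
    exists_composable (Arrow.mk ((tr F φ).map g)) ((tr F ψ).mapArrow.obj r) h
  obtain rfl : (tr F φ).obj b = c' := congr_arg Arrow.leftFunc.obj hg
  obtain rfl : (tr F φ).obj c = c'' := congr_arg Arrow.rightFunc.obj hg
  refine ⟨k, _, _, _, d, (tr F φ).map f, (tr F φ).map g, k', ?_, ?_, ?_⟩
  · exact (mkArr_tr F φ (Arrow.mk f)).symm
  · exact (mkArr_tr F φ (Arrow.mk g)).symm
  · rw [← hk, mkArr_tr]

/-- The composition of arrows. -/
noncomputable def comp (p q : Arr F) (h : tgt F p = src F q) : Arr F :=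
  mkArr F (Arrow.mk ((exists_rep₂ F p q h).choose_spec.choose_spec.choose_spec.choose_spec.choose ≫
    (exists_rep₂ F p q h).choose_spec.choose_spec.choose_spec.choose_spec.choose_spec.choose))

lemma comp_mk {j : J} {a b c : F.obj j} (f : a ⟶ b) (g : b ⟶ c) :
    comp F (mkArr F (Arrow.mk f)) (mkArr F (Arrow.mk g)) rfl = mkArr F (Arrow.mk (f ≫ g)) := by
  let H := exists_rep₂ F (mkArr F (Arrow.mk f)) (mkArr F (Arrow.mk g)) rfl
  have hf := H.choose_spec.choose_spec.choose_spec.choose_spec.choose_spec.choose_spec.1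
  have hg := H.choose_spec.choose_spec.choose_spec.choose_spec.choose_spec.choose_spec.2
  dsimp only [comp]
  generalize H.choose_spec.choose_spec.choose_spec.choose_spec.choose_spec.choose = g' at *
  generalize H.choose_spec.choose_spec.choose_spec.choose_spec.choose = f' at *
  obtain ⟨k, φ, ψ, h⟩ := (mkArr_eq_iff F _ _).1 hf
  obtain ⟨k', φ', ψ', h'⟩ := (mkArr_eq_iff F _ _).1 hg
  -- The two comparisons of representatives live at unrelated stages; `bowtie` gives a common later
  -- stage where they use the same transition functors.
  obtain ⟨m, α, β, h₁, h₂⟩ := IsFiltered.bowtie φ φ' ψ ψ'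
  dsimp only at φ ψ φ' ψ' h h'
  refine ((mkArr_eq_iff F _ _).2 ⟨m, φ ≫ α, ψ ≫ α, ?_⟩).symm
  have e₁ := congr_arg (tr F α).mapArrow.obj h
  have e₂ := congr_arg (tr F β).mapArrow.obj h'
  rw [← tr_comp_mapArrow, ← tr_comp_mapArrow] at e₁ e₂
  rw [← h₁, ← h₂] at e₂
  have := arrow_mk_comp_congr e₁ e₂
  refine Eq.trans ?_ (this.trans ?_)
  · exact congr_arg Arrow.mk ((tr F (φ ≫ α)).map_comp f g)
  · exact congr_arg Arrow.mk ((tr F (ψ ≫ α)).map_comp f' g').symm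

/-- The category structure on the filtered colimit. -/
noncomputable instance : Category.{u} (Obj F) where
  Hom x y := { f : Arr F // src F f = x ∧ tgt F f = y }
  id x := ⟨idArr F x, by obtain ⟨j, a, rfl⟩ := exists_mkObj F x; exact ⟨rfl, rfl⟩⟩
  comp f g := ⟨comp F f.1 g.1 (f.2.2.trans g.2.1.symm), by
    obtain ⟨f, rfl, rfl⟩ := f
    obtain ⟨g, h, rfl⟩ := g
    obtain ⟨j, a, b, c, f, g, rfl, rfl⟩ := exists_rep₂ F f g h.symm
    dsimp only
    rw [comp_mk]
    exact ⟨rfl, rfl⟩⟩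
  id_comp f := by
    obtain ⟨f, rfl, rfl⟩ := f
    obtain ⟨j, f, rfl⟩ := exists_mkArr F f
    exact Subtype.ext ((comp_mk F (𝟙 _) f.hom).trans (by rw [Category.id_comp]; rfl))
  comp_id f := by
    obtain ⟨f, rfl, rfl⟩ := f
    obtain ⟨j, f, rfl⟩ := exists_mkArr F f
    exact Subtype.ext ((comp_mk F f.hom (𝟙 _)).trans (by rw [Category.comp_id]; rfl))
  assoc f g h := by
    obtain ⟨f, rfl, rfl⟩ := f
    obtain ⟨g, h₁, rfl⟩ := g
    obtain ⟨h, h₂, rfl⟩ := h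
    obtain ⟨j, a, b, c, d, f, g, h, rfl, rfl, rfl⟩ := exists_rep₃ F f g h h₁.symm h₂.symm
    apply Subtype.ext
    dsimp only
    simp only [comp_mk, Category.assoc]

/-- The cocone with point the filtered colimit. -/
noncomputable def ι (j : J) : F.obj j ⥤ Obj F where
  obj := mkObj F
  map f := ⟨mkArr F (Arrow.mk f), rfl, rfl⟩
  map_comp f g := Subtype.ext (comp_mk F f g).symm

lemma ι_mapArrow_eq_iff {i j : J} (f : Arrow (F.obj i)) (g : Arrow (F.obj j)) :
    (ι F i).mapArrow.obj f = (ι F j).mapArrow.obj g ↔ arrRel F ⟨i, f⟩ ⟨j, g⟩ := by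
  rw [← mkArr_eq_iff]
  refine ⟨fun h ↦ ?_, fun h ↦ ?_⟩
  · let V (h : Arrow (Obj F)) : Arr F := h.hom.1
    exact congr_arg V h
  · have h₁ := congr_arg (src F) h
    have h₂ := congr_arg (tgt F) h
    let K : Obj F → Obj F → Arr F → Prop := fun x y f ↦ src F f = x ∧ tgt F f = y
    have : ∀ (x y x' y' : Obj F) (p q : Arr F) (hp : K x y p) (hq : K x' y' q)
      (_ : x = x') (_ : y = y') (_ : p = q),
        (Arrow.mk (show x ⟶ y from ⟨p, hp⟩)) = Arrow.mk (show x' ⟶ y' from ⟨q, hq⟩) := by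
      rintro x y _ _ p _ hp hq rfl rfl rfl; rfl
    exact this _ _ _ _ _ _ _ _ h₁ h₂ h

lemma exists_ι_mapArrow (f : Arrow (Obj F)) :
    ∃ (j : J) (f₀ : Arrow (F.obj j)), (ι F j).mapArrow.obj f₀ = f := by
  obtain ⟨x, y, f⟩ := f
  dsimp only [Functor.id_obj] at f
  obtain ⟨f, rfl, rfl⟩ := f
  obtain ⟨j, f, rfl⟩ := exists_mkArr F f
  exact ⟨j, f, rfl⟩

/-- The cocone with point the filtered colimit. -/
noncomputable def cocone : Cocone F where
  pt := Cat.of (Obj F)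
  ι :=
    { app j := (ι F j).toCatHom
      naturality i j φ := by
        apply Cat.Hom.ext
        refine CategoryTheory.Functor.ext (fun x ↦ mkObj_tr F φ x) (fun x y f ↦ ?_)
        have := (ι_mapArrow_eq_iff F ((tr F φ).mapArrow.obj (Arrow.mk f)) (Arrow.mk f)).2
          ⟨j, 𝟙 j, φ, by rw [← tr_comp_mapArrow, Category.comp_id]⟩
        exact ((Arrow.mk_eq_mk_iff _ _).1 this).2.2 }

section

variable {F} (s : Cocone F)

/-- The functor induced by a cocone. -/
def desc : Obj F ⥤ s.pt where
  obj := descObj s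
  map {x y} f := eqToHom (by rw [descArr_left, f.2.1]) ≫ (descArr s f.1).hom ≫
    eqToHom (by rw [descArr_right, f.2.2])
  map_id x := by
    obtain ⟨j, a, rfl⟩ := exists_mkObj F x
    refine (Category.id_comp _).trans ((Category.comp_id _).trans ?_)
    exact (s.ι.app j).toFunctor.map_id a
  map_comp f g := by
    obtain ⟨f, rfl, rfl⟩ := f
    obtain ⟨g, h, rfl⟩ := g
    obtain ⟨j, a, b, c, f, g, rfl, rfl⟩ := exists_rep₂ F f g h.symm
    have : ∀ (r : Arr F) (hr : r = mkArr F (Arrow.mk (f ≫ g)))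
      (h₁ : descObj s (mkObj F a) = (descArr s r).left)
      (h₂ : (descArr s r).right = descObj s (mkObj F c)),
      eqToHom h₁ ≫ (descArr s r).hom ≫ eqToHom h₂ = (s.ι.app j).toFunctor.map (f ≫ g) := by
      rintro _ rfl h₁ h₂
      exact (Category.id_comp _).trans (Category.comp_id _)
    refine (this _ (comp_mk F f g) _ _).trans ?_
    rw [Functor.map_comp]
    congr 1
    · exact ((Category.id_comp _).trans (Category.comp_id _)).symm
    · exact ((Category.id_comp _).trans (Category.comp_id _)).symm

lemma desc_mapArrow (j : J) (f : Arrow (F.obj j)) :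
    (desc s).mapArrow.obj ((ι F j).mapArrow.obj f) = (s.ι.app j).toFunctor.mapArrow.obj f := by
  have : (desc s).map ((ι F j).map f.hom) = (s.ι.app j).toFunctor.map f.hom :=
    (Category.id_comp _).trans (Category.comp_id _)
  exact congr_arg Arrow.mk this

lemma ι_comp_desc (j : J) : ι F j ⋙ desc s = (s.ι.app j).toFunctor :=
  CategoryTheory.Functor.ext (fun _ ↦ rfl) (fun _ _ _ ↦
    ((Category.id_comp _).trans (Category.comp_id _)).trans
      ((Category.id_comp _).trans (Category.comp_id _)).symm)

/-- The morphism in `Cat` induced by a cocone. -/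
noncomputable def descHom : (cocone F).pt ⟶ s.pt := (desc s).toCatHom

end

section

variable {F} {c : Cocone F}

/-- The comparison functor from the given colimit to the explicit cocone reduces this to equality in
`Obj F`; the explicit cocone need not be known to be a colimit. -/
lemma arrRel_of_isColimit (hc : IsColimit c) {i j : J} (f : Arrow (F.obj i)) (g : Arrow (F.obj j))
    (h : (c.ι.app i).toFunctor.mapArrow.obj f = (c.ι.app j).toFunctor.mapArrow.obj g) :
    arrRel F ⟨i, f⟩ ⟨j, g⟩ := by
  rw [← ι_mapArrow_eq_iff]
  have hi := congr_arg Cat.Hom.toFunctor (hc.fac (cocone F) i)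
  have hj := congr_arg Cat.Hom.toFunctor (hc.fac (cocone F) j)
  have := congr_arg (hc.desc (cocone F)).toFunctor.mapArrow.obj h
  exact (congr_arg (fun K : F.obj i ⥤ Obj F ↦ K.mapArrow.obj f) hi).symm.trans
    (this.trans (congr_arg (fun K : F.obj j ⥤ Obj F ↦ K.mapArrow.obj g) hj))

/-- The colimit is a retract of the explicit category, where every arrow comes from some stage. -/
lemma exists_of_isColimit (hc : IsColimit c) (f : Arrow c.pt) :
    ∃ (j : J) (f₀ : Arrow (F.obj j)), (c.ι.app j).toFunctor.mapArrow.obj f₀ = f := by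
  have h : hc.desc (cocone F) ≫ descHom c = 𝟙 c.pt := hc.hom_ext (fun j ↦ by
    rw [← Category.assoc, hc.fac, Category.comp_id]
    apply Cat.Hom.ext
    exact ι_comp_desc c j)
  obtain ⟨j, f₀, hf₀⟩ := exists_ι_mapArrow F ((hc.desc (cocone F)).toFunctor.mapArrow.obj f)
  refine ⟨j, f₀, ?_⟩
  rw [← desc_mapArrow, hf₀]
  exact congr_arg (fun K : c.pt ⟶ c.pt ↦ K.toFunctor.mapArrow.obj f) h

end

end FilteredColimitCat

/-! ### The category of small categories is locally presentable -/

/-- The category with two objects and one non-identity arrow. -/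
inductive IntervalCat : Type u
  | zero
  | one

namespace IntervalCat

instance : Preorder IntervalCat.{u} where
  le x y := x = zero ∨ y = one
  le_refl x := by cases x <;> simp
  le_trans x y z := by cases x <;> cases y <;> cases z <;> simp

lemma zero_le (x : IntervalCat.{u}) : zero ≤ x := Or.inl rfl

lemma not_one_le_zero : ¬ (one : IntervalCat.{u}) ≤ zero := by rintro (h | h) <;> cases h

/-- The non-identity arrow. -/
def arr : (zero : IntervalCat.{u}) ⟶ one := homOfLE (zero_le _)

/-- The functor from the interval corresponding to an arrow. -/
def functor {C : Type*} [Category* C] {a b : C} (f : a ⟶ b) : IntervalCat.{u} ⥤ C where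
  obj | zero => a | one => b
  map {x y} h := match x, y, h with
    | zero, zero, _ => 𝟙 a
    | zero, one, _ => f
    | one, one, _ => 𝟙 b
    | one, zero, h => (not_one_le_zero (leOfHom h)).elim
  map_id x := by cases x <;> rfl
  map_comp {x y z} h k := by
    cases x <;> cases y <;> cases z <;>
      first
      | exact (not_one_le_zero (leOfHom h)).elim
      | exact (not_one_le_zero (leOfHom k)).elim
      | simp

lemma functor_ext {C : Type*} [Category* C] {F G : IntervalCat.{u} ⥤ C}
    (h : Arrow.mk (F.map arr) = Arrow.mk (G.map arr)) : F = G := by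
  have h₀ : F.obj zero = G.obj zero := congr_arg Arrow.leftFunc.obj h
  have h₁ : F.obj one = G.obj one := congr_arg Arrow.rightFunc.obj h
  have h₂ := ((Arrow.mk_eq_mk_iff _ _).1 h).2.2
  refine CategoryTheory.Functor.ext (fun x ↦ by cases x <;> assumption) (fun x y f ↦ ?_)
  cases x <;> cases y
  · obtain rfl := Subsingleton.elim (𝟙 _) f
    simp
  · obtain rfl := Subsingleton.elim arr f
    exact h₂
  · exact (not_one_le_zero (leOfHom f)).elim
  · obtain rfl := Subsingleton.elim (𝟙 _) f
    simp

/-- Functors from the interval to a category identify to arrows in this category. -/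
def homEquiv (C : Cat.{u, u}) : (Cat.of IntervalCat.{u} ⟶ C) ≃ Arrow C where
  toFun F := Arrow.mk (F.toFunctor.map arr)
  invFun f := (functor f.hom).toCatHom
  left_inv F := by
    apply Cat.Hom.ext
    exact functor_ext rfl
  right_inv f := rfl

lemma homEquiv_comp {C D : Cat.{u, u}} (F : Cat.of IntervalCat.{u} ⟶ C) (G : C ⟶ D) :
    homEquiv D (F ≫ G) = G.toFunctor.mapArrow.obj (homEquiv C F) := rfl

end IntervalCat

/-- Functors out of the interval are arrows, and the arrows of a filtered colimit of categories are
computed as in sets. -/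
lemma isFinitelyPresentable_interval :
    IsFinitelyPresentable.{u} (Cat.of IntervalCat.{u}) := by
  rw [isFinitelyPresentable_iff_preservesFilteredColimitsOfSize]
  refine ⟨fun J _ _ ↦ ⟨fun {F} ↦ ⟨fun {c} hc ↦ ⟨Types.FilteredColimit.isColimitOf' _ _ ?_ ?_⟩⟩⟩⟩
  · intro f
    obtain ⟨j, f₀, hf₀⟩ := FilteredColimitCat.exists_of_isColimit hc (IntervalCat.homEquiv _ f)
    exact ⟨j, (IntervalCat.homEquiv _).symm f₀, (IntervalCat.homEquiv _).injective
      (hf₀.symm.trans (((IntervalCat.homEquiv_comp _ _).trans (by simp)).symm))⟩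
  · intro j x y h
    obtain ⟨k, φ, ψ, h'⟩ := FilteredColimitCat.arrRel_of_isColimit hc
      (IntervalCat.homEquiv _ x) (IntervalCat.homEquiv _ y) (congr_arg (IntervalCat.homEquiv _) h)
    dsimp only at φ ψ h'
    -- `arrRel` allows two different transition maps, while the criterion wants a single one, so
    -- they are coequalized.
    refine ⟨IsFiltered.coeq φ ψ, φ ≫ IsFiltered.coeqHom φ ψ, (IntervalCat.homEquiv _).injective ?_⟩
    have e := congr_arg (FilteredColimitCat.tr F (IsFiltered.coeqHom φ ψ)).mapArrow.obj h'
    rw [← FilteredColimitCat.tr_comp_mapArrow, ← FilteredColimitCat.tr_comp_mapArrow,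
      ← IsFiltered.coeq_condition] at e
    exact e

lemma isIso_of_functorIsIso {C D : Cat.{u, u}} (F : C ⟶ D) [F.toFunctor.IsIso] : IsIso F :=
  ⟨F.toFunctor.asIsomorphism.inverse.toCatHom, by
    apply Cat.Hom.ext; exact F.toFunctor.asIsomorphism.unit_eq.symm, by
    apply Cat.Hom.ext; exact F.toFunctor.asIsomorphism.counit_eq⟩

/-- Objects are recovered from their identities, so bijectivity on arrows passes to objects and then
to each hom-set. -/
lemma isIso_of_bijective_mapArrow {C D : Cat.{u, u}} (F : C ⟶ D)
    (hF : Function.Bijective F.toFunctor.mapArrow.obj) : IsIso F := by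
  have hobj : Function.Bijective F.toFunctor.obj := by
    refine ⟨fun x y h ↦ ?_, fun y ↦ ?_⟩
    · have : F.toFunctor.mapArrow.obj (Arrow.mk (𝟙 x)) =
          F.toFunctor.mapArrow.obj (Arrow.mk (𝟙 y)) := by
        simp only [Functor.mapArrow_obj, Arrow.mk_left, Arrow.mk_right, Arrow.mk_hom,
          CategoryTheory.Functor.map_id]
        rw [h]
      exact congr_arg Arrow.leftFunc.obj (hF.1 this)
    · obtain ⟨f, hf⟩ := hF.2 (Arrow.mk (𝟙 y))
      exact ⟨f.left, congr_arg Arrow.leftFunc.obj hf⟩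
  have : F.toFunctor.IsIso :=
    { faithful := ⟨fun {x y} f g h ↦ by
        have : F.toFunctor.mapArrow.obj (Arrow.mk f) = F.toFunctor.mapArrow.obj (Arrow.mk g) :=
          congr_arg Arrow.mk h
        exact Arrow.mk_injective _ _ (hF.1 this)⟩
      full := ⟨fun {x y} g ↦ by
        obtain ⟨⟨x', y', f⟩, hf⟩ := hF.2 (Arrow.mk g)
        obtain rfl : x' = x := hobj.1 (congr_arg Arrow.leftFunc.obj hf)
        obtain rfl : y' = y := hobj.1 (congr_arg Arrow.rightFunc.obj hf)
        exact ⟨f, Arrow.mk_injective _ _ hf⟩⟩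
      bijective_obj := hobj }
  exact isIso_of_functorIsIso F

lemma isStrongGenerator_interval :
    (ObjectProperty.singleton (Cat.of IntervalCat.{u})).IsStrongGenerator := by
  rw [ObjectProperty.isStrongGenerator_iff]
  refine ⟨fun C D F G h ↦ ?_, fun C D F _ hF ↦ ?_⟩
  · replace h (f : Arrow C) : F.toFunctor.mapArrow.obj f = G.toFunctor.mapArrow.obj f := by
      obtain ⟨f, rfl⟩ := (IntervalCat.homEquiv C).surjective f
      rw [← IntervalCat.homEquiv_comp, h _ (by simp), IntervalCat.homEquiv_comp]
    apply Cat.Hom.ext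
    refine CategoryTheory.Functor.ext (fun x ↦ congr_arg Arrow.leftFunc.obj (h (Arrow.mk (𝟙 x))))
      (fun x y f ↦ ((Arrow.mk_eq_mk_iff _ _).1 (h (Arrow.mk f))).2.2)
  · apply isIso_of_bijective_mapArrow
    refine ⟨fun f g h ↦ ?_, fun f ↦ ?_⟩
    · obtain ⟨f, rfl⟩ := (IntervalCat.homEquiv C).surjective f
      obtain ⟨g, rfl⟩ := (IntervalCat.homEquiv C).surjective g
      rw [← IntervalCat.homEquiv_comp, ← IntervalCat.homEquiv_comp] at h
      rw [(cancel_mono F).1 ((IntervalCat.homEquiv D).injective h)]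
    · obtain ⟨f, rfl⟩ := (IntervalCat.homEquiv D).surjective f
      obtain ⟨g, rfl⟩ := hF (Cat.of IntervalCat) (by simp) f
      exact ⟨_, (IntervalCat.homEquiv_comp _ _).symm⟩

/-- The category of small categories is locally presentable. -/
instance isLocallyPresentable_cat : IsLocallyPresentable.{u} Cat.{u, u} where
  exists_cardinal := by
    refine ⟨.aleph0, Cardinal.fact_isRegular_aleph0, ?_⟩
    have := Cardinal.fact_isRegular_aleph0.{u}
    rw [IsCardinalLocallyPresentable.iff_exists_isStrongGenerator]
    refine ⟨ObjectProperty.singleton (Cat.of IntervalCat.{u}), inferInstance,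
      isStrongGenerator_interval, ?_⟩
    rintro C ⟨⟩
    exact isFinitelyPresentable_interval

/-! ### Small classes of morphisms permit the small object argument -/

/-- Each domain is presentable for some regular cardinal. As there is only a small set of domains,
one regular cardinal bounds them all, and transfinite compositions of that length are then
preserved. -/
lemma hasSmallObjectArgument_of_isLocallyPresentable {C : Type u} [Category.{v} C]
    [LocallySmall.{w} C] [HasColimitsOfSize.{w, w} C]
    [IsLocallyPresentable.{w} C] (I : MorphismProperty C) [MorphismProperty.IsSmall.{w} I] :
    MorphismProperty.HasSmallObjectArgument.{w} I := by
  obtain ⟨ι, A, B, f, rfl⟩ := (MorphismProperty.isSmall_iff_eq_ofHoms.{w} I).1 inferInstance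
  have hA (i : ι) : ∃ (κ : Cardinal.{w}) (_ : Fact κ.IsRegular), IsCardinalPresentable (A i) κ :=
    (inferInstance : IsPresentable.{w} (A i)).exists_cardinal
  choose κ hκ hA using hA
  obtain ⟨κ', hκ', h⟩ := HasCardinalLT.exists_regular_cardinal_forall.{w} (fun i ↦ (κ i).out)
  have : Fact κ'.IsRegular := ⟨hκ'⟩
  have : Nonempty κ'.ord.ToType := by simpa using hκ'.ne_zero
  have := WellFoundedLT.toOrderBot κ'.ord.ToType
  refine ⟨κ', inferInstance, inferInstance, { preservesColimit := ?_ }⟩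
  rintro _ _ X Y _ ⟨i⟩ g hg
  have hi : κ i ≤ κ' := by
    have := (h i).le
    simpa using this
  have : IsCardinalPresentable (A i) κ' := isCardinalPresentable_of_le _ hi
  have := preservesColimitsOfShape_of_isCardinalPresentable (A i) κ' κ'.ord.ToType
  infer_instance

/-! ### Groupoidal equivalences -/

instance : (groupoidalEquivalences.{u}).HasTwoOutOfThreeProperty where
  comp_mem {A B C} F G hF hG Z _ := by
    have := hF Z
    have := hG Z
    exact inferInstanceAs ((Functor.whiskeringLeft B C Z).obj G.toFunctor ⋙
      (Functor.whiskeringLeft A B Z).obj F.toFunctor).IsEquivalence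
  of_postcomp {A B C} F G hG hFG Z _ := by
    have := hG Z
    have : ((Functor.whiskeringLeft B C Z).obj G.toFunctor ⋙
      (Functor.whiskeringLeft A B Z).obj F.toFunctor).IsEquivalence := hFG Z
    exact Functor.isEquivalence_of_comp_left ((Functor.whiskeringLeft B C Z).obj G.toFunctor) _
  of_precomp {A B C} F G hF hFG Z _ := by
    have := hF Z
    have : ((Functor.whiskeringLeft B C Z).obj G.toFunctor ⋙
      (Functor.whiskeringLeft A B Z).obj F.toFunctor).IsEquivalence := hFG Z
    exact Functor.isEquivalence_of_comp_right _ ((Functor.whiskeringLeft A B Z).obj F.toFunctor)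

section

variable {A B : Type u} [Category.{u} A] [Category.{u} B]

lemma isIso_of_groupoid_target {Z : Type u} [Groupoid.{u} Z] {G H : A ⥤ Z} (α : G ⟶ H) :
    IsIso α :=
  NatIso.isIso_of_isIso_app α

/-- Precomposition preserves adjunctions, and natural transformations between functors to a groupoid
are invertible, so the induced unit and counit are isomorphisms. -/
lemma CategoryTheory.Adjunction.isEquivalence_whiskeringLeft {F : A ⥤ B} {G : B ⥤ A} (adj : F ⊣ G)
    (Z : Type u) [Groupoid.{u} Z] :
    ((Functor.whiskeringLeft A B Z).obj F).IsEquivalence ∧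
      ((Functor.whiskeringLeft B A Z).obj G).IsEquivalence := by
  let e := adj.whiskerLeft Z
  have h₁ (X) : IsIso (e.unit.app X) := isIso_of_groupoid_target _
  have h₂ (X) : IsIso (e.counit.app X) := isIso_of_groupoid_target _
  exact ⟨e.toEquivalence.isEquivalence_inverse, e.toEquivalence.isEquivalence_functor⟩

lemma groupoidalEquivalences_of_leftAdjoint {F : A ⥤ B} {G : B ⥤ A} (adj : F ⊣ G) :
    groupoidalEquivalences F.toCatHom :=
  fun Z _ ↦ (adj.isEquivalence_whiskeringLeft Z).1

lemma groupoidalEquivalences_of_rightAdjoint {F : A ⥤ B} {G : B ⥤ A} (adj : F ⊣ G) :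
    groupoidalEquivalences G.toCatHom :=
  fun Z _ ↦ (adj.isEquivalence_whiskeringLeft Z).2

lemma groupoidalEquivalences_of_isEquivalence (F : A ⥤ B) [F.IsEquivalence] :
    groupoidalEquivalences F.toCatHom :=
  groupoidalEquivalences_of_leftAdjoint F.asEquivalence.toAdjunction

/-- Every functor to a groupoid factors through the quotient, and precomposition with a full functor
that is the identity on objects is fully faithful. -/
lemma groupoidalEquivalences_quotient (r : HomRel A)
    (hr : ∀ (Z : Type u) [Groupoid.{u} Z] (K : A ⥤ Z) ⦃x y : A⦄ (f g : x ⟶ y),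
      r f g → K.map f = K.map g) :
    (injectiveOnObjects.{u} ⊓ groupoidalEquivalences.{u}) (Quotient.functor r).toCatHom := by
  refine ⟨fun x y h ↦ congr_arg Quotient.as h, fun Z _ ↦ ?_⟩
  exact
    { full := inferInstanceAs ((Functor.whiskeringLeft A _ Z).obj (Quotient.functor r)).Full
      faithful := inferInstanceAs ((Functor.whiskeringLeft A _ Z).obj (Quotient.functor r)).Faithful
      essSurj := ⟨fun K ↦ ⟨CategoryTheory.Quotient.lift r K (fun x y f g h ↦ hr Z K f g h),
        ⟨CategoryTheory.Quotient.lift.isLift r K _⟩⟩⟩ }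

/-- Fullness of all precomposition functors with groupoids as targets implies faithfulness. -/
lemma faithful_whiskeringLeft_of_full (F : A ⥤ B)
    (h : ∀ (Z : Type u) [Groupoid.{u} Z], ((Functor.whiskeringLeft A B Z).obj F).Full)
    (Z : Type u) [Groupoid.{u} Z] : ((Functor.whiskeringLeft A B Z).obj F).Faithful where
  map_injective {G H} α β hαβ := by
    -- Agreement of `α` and `β` is constant along morphisms because `Z` is a groupoid. It is thus a
    -- functor to a discrete category of truth values, and fullness for that target compares it with
    -- the constant functor at `True`.
    let P (b : B) : Prop := α.app b = β.app b
    have hP {b b' : B} (f : b ⟶ b') : P b = P b' := by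
      have h₁ := α.naturality f
      have h₂ := β.naturality f
      refine propext ⟨fun h ↦ ?_, fun h ↦ ?_⟩
      · dsimp only [P] at h ⊢
        rw [← cancel_epi (G.map f), h₁, h₂, h]
      · dsimp only [P] at h ⊢
        rw [← cancel_mono (H.map f), ← h₁, ← h₂, h]
    let T : B ⥤ Discrete (ULift.{u} Prop) :=
      { obj b := ⟨⟨P b⟩⟩
        map f := Discrete.eqToHom (congr_arg ULift.up (hP f)) }
    let T' : B ⥤ Discrete (ULift.{u} Prop) := (Functor.const B).obj ⟨⟨True⟩⟩
    have hF (a : A) : P (F.obj a) := NatTrans.congr_app hαβ a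
    let τ : F ⋙ T' ⟶ F ⋙ T :=
      { app a := Discrete.eqToHom (congr_arg ULift.up (eq_true (hF a)).symm) }
    have := h (Discrete (ULift.{u} Prop))
    let σ : T' ⟶ T := ((Functor.whiskeringLeft A B _).obj F).preimage τ
    ext b
    exact of_eq_true (congr_arg ULift.down (Discrete.eq_of_hom (σ.app b))).symm

end

/-! ### Trivial cofibrations and lifting against groupoids -/

/-- A functor to a groupoid extends along a functor which is injective on objects and
a groupoidal equivalence. -/
lemma exists_extension {A B : Cat.{u, u}} {i : A ⟶ B}
    (hi : (injectiveOnObjects.{u} ⊓ groupoidalEquivalences.{u}) i)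
    {Z : Type u} [Groupoid.{u} Z] (K : A ⥤ Z) : ∃ L : B ⥤ Z, i.toFunctor ⋙ L = K := by
  have := hi.2 Z
  let L := ((Functor.whiskeringLeft A B Z).obj i.toFunctor).objPreimage K
  let e : i.toFunctor ⋙ L ≅ K := ((Functor.whiskeringLeft A B Z).obj i.toFunctor).objObjPreimageIso K
  -- The extension `L` is only correct up to isomorphism. It is replaced by `K` on the image of `i`,
  -- where injectivity makes the preimage unique, and its morphisms are conjugated by the resulting
  -- isomorphisms `φ`.
  classical
  let obj (b : B) : Z := if h : ∃ a, i.toFunctor.obj a = b then K.obj h.choose else L.obj b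
  let φ (b : B) : L.obj b ≅ obj b :=
    if h : ∃ a, i.toFunctor.obj a = b then
      eqToIso (congr_arg L.obj h.choose_spec.symm) ≪≫ e.app h.choose ≪≫ eqToIso (by simp [obj, dif_pos h])
    else eqToIso (by simp [obj, dif_neg h])
  have hobj (a : A) : obj (i.toFunctor.obj a) = K.obj a := by
    have h : ∃ a', i.toFunctor.obj a' = i.toFunctor.obj a := ⟨a, rfl⟩
    have : h.choose = a := hi.1 h.choose_spec
    dsimp only [obj]
    rw [dif_pos h, this]
  have hφ (a : A) : (φ (i.toFunctor.obj a)).hom = e.hom.app a ≫ eqToHom (hobj a).symm := by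
    have h : ∃ a', i.toFunctor.obj a' = i.toFunctor.obj a := ⟨a, rfl⟩
    have : ∀ (a' : A) (_ : a' = a) (h₁ : L.obj (i.toFunctor.obj a) = L.obj (i.toFunctor.obj a'))
      (h₂ : K.obj a' = obj (i.toFunctor.obj a)),
      eqToHom h₁ ≫ e.hom.app a' ≫ eqToHom h₂ = e.hom.app a ≫ eqToHom (hobj a).symm := by
      rintro _ rfl h₁ h₂
      simp
    dsimp only [φ]
    rw [dif_pos h]
    exact this h.choose (hi.1 h.choose_spec) (congr_arg L.obj h.choose_spec.symm)
      (by simp [obj, dif_pos h])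
  have hφ' (a : A) : (φ (i.toFunctor.obj a)).inv = eqToHom (hobj a) ≫ e.inv.app a := by
    rw [← cancel_mono (φ (i.toFunctor.obj a)).hom, Iso.inv_hom_id, hφ]
    simp
  let L' : B ⥤ Z :=
    { obj := obj
      map {b b'} f := (φ b).inv ≫ L.map f ≫ (φ b').hom }
  refine ⟨L', CategoryTheory.Functor.ext hobj (fun a a' f ↦ ?_)⟩
  dsimp [L']
  have := e.hom.naturality f
  dsimp at this
  rw [hφ, hφ', reassoc_of% this]
  simp

namespace CategoryTheory

/-- The functor to the category of arrows corresponding to a natural transformation. -/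
@[simps]
def NatTrans.toArrowFunctor {A Z : Type u} [Category.{u} A] [Category.{u} Z] {G H : A ⥤ Z}
    (α : G ⟶ H) : A ⥤ Arrow Z where
  obj a := Arrow.mk (α.app a)
  map f := Arrow.homMk (G.map f) (H.map f)

lemma Functor.toArrow_ext {A Z : Type u} [Category.{u} A] [Category.{u} Z] {K L : A ⥤ Arrow Z}
    (h₁ : K ⋙ Arrow.leftFunc = L ⋙ Arrow.leftFunc)
    (h₂ : K ⋙ Arrow.rightFunc = L ⋙ Arrow.rightFunc)
    (h : ∀ a, K.obj a = L.obj a) : K = L := by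
  refine Functor.ext h (fun a b f ↦ ?_)
  apply Arrow.hom_ext
  · refine (Functor.congr_hom h₁ f).trans ?_
    simp only [Arrow.comp_left, Arrow.eqToHom_left]
    rfl
  · refine (Functor.congr_hom h₂ f).trans ?_
    simp only [Arrow.comp_right, Arrow.eqToHom_right]
    rfl

end CategoryTheory

/-- The source and target functors. -/
def arrowEndpoints (Z : Type u) [Category.{u} Z] : Cat.of (Arrow Z) ⟶ Cat.of (Z × Z) :=
  (Arrow.leftFunc.prod' Arrow.rightFunc).toCatHom

/-- The functor to the terminal category. -/
def toPoint (C : Cat.{u, u}) : C ⟶ Cat.of (Discrete PUnit.{u + 1}) :=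
  (Functor.star C).toCatHom

lemma toPoint_mem_rlp {Z : Type u} [Groupoid.{u} Z] :
    (injectiveOnObjects.{u} ⊓ groupoidalEquivalences.{u}).rlp (toPoint (Cat.of Z)) :=
  fun A B i hi ↦ ⟨fun {f g} sq ↦ by
    obtain ⟨L, hL⟩ := exists_extension hi (Z := Z) f.toFunctor
    exact ⟨⟨{ l := L.toCatHom
              fac_left := by apply Cat.Hom.ext; exact hL
              fac_right := by apply Cat.Hom.ext; exact Functor.punit_ext' _ _ }⟩⟩⟩

/-- A lift is a natural transformation between two functors on `B` with prescribed restriction to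
`A`; fullness of precomposition supplies it. -/
lemma arrowEndpoints_mem_rlp {Z : Type u} [Groupoid.{u} Z] :
    (injectiveOnObjects.{u} ⊓ groupoidalEquivalences.{u}).rlp (arrowEndpoints Z) :=
  fun A B i hi ↦ ⟨fun {f g} sq ↦ by
    have := hi.2 Z
    have sq' : f.toFunctor ⋙ (Arrow.leftFunc.prod' Arrow.rightFunc) =
      i.toFunctor ⋙ g.toFunctor := congr_arg Cat.Hom.toFunctor sq.w
    let G : B ⥤ Z := g.toFunctor ⋙ CategoryTheory.Prod.fst Z Z
    let H : B ⥤ Z := g.toFunctor ⋙ CategoryTheory.Prod.snd Z Z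
    have h₁ : f.toFunctor ⋙ Arrow.leftFunc = i.toFunctor ⋙ G :=
      congr_arg (fun (K : A ⥤ Z × Z) ↦ K ⋙ CategoryTheory.Prod.fst Z Z) sq'
    have h₂ : f.toFunctor ⋙ Arrow.rightFunc = i.toFunctor ⋙ H :=
      congr_arg (fun (K : A ⥤ Z × Z) ↦ K ⋙ CategoryTheory.Prod.snd Z Z) sq'
    let α : i.toFunctor ⋙ G ⟶ i.toFunctor ⋙ H :=
      eqToHom h₁.symm ≫ Functor.whiskerLeft f.toFunctor Arrow.leftToRight ≫ eqToHom h₂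
    let β : G ⟶ H := ((Functor.whiskeringLeft A B Z).obj i.toFunctor).preimage α
    have hβ : Functor.whiskerLeft i.toFunctor β = α :=
      ((Functor.whiskeringLeft A B Z).obj i.toFunctor).map_preimage α
    exact ⟨⟨{ l := β.toArrowFunctor.toCatHom
              fac_left := by
                apply Cat.Hom.ext
                refine Functor.toArrow_ext h₁.symm h₂.symm (fun a ↦ ?_)
                have := NatTrans.congr_app hβ a
                dsimp [α] at this
                refine (Arrow.mk_eq_mk_iff _ _).2 ⟨Functor.congr_obj h₁.symm a,
                  Functor.congr_obj h₂.symm a, ?_⟩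
                refine this.trans ?_
                simp only [eqToHom_app]
                rfl
              fac_right := by
                apply Cat.Hom.ext
                rfl }⟩⟩⟩

lemma eqToHom_conj_eqToHom_conj {C : Type u} [Category.{v} C] {x y x' y' : C} (f : x ⟶ y)
    (h₁ : x = x') (h₂ : x' = x) (h₃ : y = y') (h₄ : y' = y) :
    eqToHom h₁ ≫ (eqToHom h₂ ≫ f ≫ eqToHom h₃) ≫ eqToHom h₄ = f := by
  subst h₁ h₃
  simp

/-- Characterization of the groupoidal equivalences which are injective on objects as a class of
morphisms having the left lifting property. -/
lemma groupoidalEquivalences_of_lifting {A B : Cat.{u, u}} (i : A ⟶ B)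
    (h₁ : ∀ (Z : Type u) [Groupoid.{u} Z], HasLiftingProperty i (toPoint (Cat.of Z)))
    (h₂ : ∀ (Z : Type u) [Groupoid.{u} Z], HasLiftingProperty i (arrowEndpoints Z)) :
    groupoidalEquivalences i := by
  have hfull (Z : Type u) [Groupoid.{u} Z] :
      ((Functor.whiskeringLeft A B Z).obj i.toFunctor).Full := ⟨fun {G H} α ↦ by
    let G' : B ⥤ Z := G
    let H' : B ⥤ Z := H
    let α' : i.toFunctor ⋙ G' ⟶ i.toFunctor ⋙ H' := α
    -- A natural transformation is a functor to the arrow category with prescribed endpoints, so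
    -- extending `α` along `i` is a lifting problem.
    have sq : CommSq (α'.toArrowFunctor.toCatHom) i (arrowEndpoints Z) (G'.prod' H').toCatHom := ⟨by
      apply Cat.Hom.ext
      rfl⟩
    have : sq.HasLift := (h₂ Z).sq_hasLift sq
    let L : B ⥤ Arrow Z := sq.lift.toFunctor
    have hL₁ : i.toFunctor ⋙ L = α'.toArrowFunctor := congr_arg Cat.Hom.toFunctor sq.fac_left
    have hL₂ : L ⋙ (Arrow.leftFunc.prod' Arrow.rightFunc) = G'.prod' H' :=
      congr_arg Cat.Hom.toFunctor sq.fac_right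
    have e₁ : L ⋙ Arrow.leftFunc = G' :=
      congr_arg (fun (K : B ⥤ Z × Z) ↦ K ⋙ CategoryTheory.Prod.fst Z Z) hL₂
    have e₂ : L ⋙ Arrow.rightFunc = H' :=
      congr_arg (fun (K : B ⥤ Z × Z) ↦ K ⋙ CategoryTheory.Prod.snd Z Z) hL₂
    refine ⟨eqToHom e₁.symm ≫ Functor.whiskerLeft L Arrow.leftToRight ≫ eqToHom e₂, ?_⟩
    ext a
    have := ((Arrow.mk_eq_mk_iff _ _).1 (Functor.congr_obj hL₁ a)).2.2
    have h₃ : Arrow.leftToRight.app (L.obj (i.toFunctor.obj a)) =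
      eqToHom (congr_arg Arrow.left (Functor.congr_obj hL₁ a)) ≫ α.app a ≫
        eqToHom (congr_arg Arrow.right (Functor.congr_obj hL₁ a)).symm := this
    dsimp at h₃ ⊢
    rw [h₃, eqToHom_app, eqToHom_app]
    exact eqToHom_conj_eqToHom_conj _ _ _ _ _⟩
  intro Z _
  exact
    { full := hfull Z
      faithful := faithful_whiskeringLeft_of_full _ (fun Z _ ↦ hfull Z) Z
      essSurj := ⟨fun K ↦ by
        have sq : CommSq (Functor.toCatHom K) i (toPoint (Cat.of Z)) (toPoint B) := ⟨rfl⟩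
        have : sq.HasLift := (h₁ Z).sq_hasLift sq
        exact ⟨sq.lift.toFunctor, ⟨eqToIso (congr_arg Cat.Hom.toFunctor sq.fac_left)⟩⟩⟩ }

/-! ### Trivial fibrations -/

/-- The functors between small categories which are equivalences of categories and are
surjective on objects. -/
def surjectiveEquivalences : MorphismProperty Cat.{u, u} :=
  fun _ _ F => Function.Surjective F.toFunctor.obj ∧ F.toFunctor.Full ∧ F.toFunctor.Faithful

lemma surjectiveEquivalences_le_groupoidalEquivalences :
    surjectiveEquivalences.{u} ≤ groupoidalEquivalences := by
  rintro A B F ⟨h₁, h₂, h₃⟩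
  have : F.toFunctor.IsEquivalence := { essSurj := ⟨fun b ↦ by
    obtain ⟨a, rfl⟩ := h₁ b
    exact ⟨a, ⟨Iso.refl _⟩⟩⟩ }
  exact groupoidalEquivalences_of_isEquivalence F.toFunctor

/-- Objects are lifted one by one: through `f` on the image of `i`, unambiguously by injectivity,
and by surjectivity of `p` elsewhere. Full faithfulness then determines the morphisms. -/
lemma hasLiftingProperty_of_surjectiveEquivalences {A B X Y : Cat.{u, u}} {i : A ⟶ B} {p : X ⟶ Y}
    (hi : injectiveOnObjects i) (hp : surjectiveEquivalences p) : HasLiftingProperty i p where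
  sq_hasLift {f g} sq := by
    obtain ⟨h₁, h₂, h₃⟩ := hp
    have sq' : f.toFunctor ⋙ p.toFunctor = i.toFunctor ⋙ g.toFunctor :=
      congr_arg Cat.Hom.toFunctor sq.w
    have hobj (b : B) : ∃ x, p.toFunctor.obj x = g.toFunctor.obj b ∧
        ∀ a, i.toFunctor.obj a = b → f.toFunctor.obj a = x := by
      by_cases h : ∃ a, i.toFunctor.obj a = b
      · obtain ⟨a, rfl⟩ := h
        exact ⟨f.toFunctor.obj a, Functor.congr_obj sq' a, fun a' ha' ↦ by rw [hi ha']⟩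
      · obtain ⟨x, hx⟩ := h₁ (g.toFunctor.obj b)
        exact ⟨x, hx, fun a ha ↦ (h ⟨a, ha⟩).elim⟩
    choose obj hobj hobj' using hobj
    let L : B ⥤ X :=
      { obj := obj
        map {b b'} φ := p.toFunctor.preimage
          (eqToHom (hobj b) ≫ g.toFunctor.map φ ≫ eqToHom (hobj b').symm)
        map_id b := p.toFunctor.map_injective (by simp)
        map_comp φ ψ := p.toFunctor.map_injective (by simp) }
    refine ⟨⟨{ l := L.toCatHom, fac_left := ?_, fac_right := ?_ }⟩⟩
    · apply Cat.Hom.ext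
      refine CategoryTheory.Functor.ext (fun a ↦ (hobj' _ a rfl).symm) (fun a a' φ ↦ ?_)
      apply p.toFunctor.map_injective
      have := Functor.congr_hom sq' φ
      dsimp at this
      change p.toFunctor.map (L.map (i.toFunctor.map φ)) = _
      simp [L, eqToHom_map, this]
    · apply Cat.Hom.ext
      refine CategoryTheory.Functor.ext hobj (fun b b' φ ↦ ?_)
      change p.toFunctor.map (L.map φ) = _
      simp [L]

/-- The objects of the category which factors a functor `F : A ⥤ B` as a functor which
is injective on objects followed by a surjective equivalence. -/
structure Cylinder {A B : Type u} [Category.{u} A] [Category.{u} B] (F : A ⥤ B) : Type u where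
  /-- an object of one of the two categories -/
  as : A ⊕ B

namespace Cylinder

variable {A B : Type u} [Category.{u} A] [Category.{u} B] (F : A ⥤ B)

/-- The underlying object in the target of the functor. -/
def toTarget {F : A ⥤ B} (x : Cylinder F) : B := Sum.elim F.obj id x.as

instance : Category.{u} (Cylinder F) where
  Hom x y := x.toTarget ⟶ y.toTarget
  id x := 𝟙 x.toTarget
  comp {x y z} f g := CategoryStruct.comp (obj := B) f g

/-- The inclusion of the source in the cylinder. -/
def inl : A ⥤ Cylinder F where
  obj a := ⟨Sum.inl a⟩
  map f := F.map f
  map_id := F.map_id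
  map_comp := F.map_comp

/-- The projection from the cylinder. -/
def π : Cylinder F ⥤ B where
  obj x := x.toTarget
  map f := f
  map_id _ := rfl
  map_comp _ _ := rfl

lemma injectiveOnObjects_inl : injectiveOnObjects (inl F).toCatHom := by
  intro x y h
  exact Sum.inl_injective (congr_arg Cylinder.as h)

lemma surjectiveEquivalences_π : surjectiveEquivalences (π F).toCatHom :=
  ⟨fun b ↦ ⟨⟨Sum.inr b⟩, rfl⟩, ⟨fun f ↦ ⟨f, rfl⟩⟩, ⟨fun h ↦ h⟩⟩

end Cylinder

instance : MorphismProperty.HasFactorization injectiveOnObjects.{u} surjectiveEquivalences where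
  nonempty_mapFactorizationData F :=
    ⟨{  Z := Cat.of (Cylinder F.toFunctor)
        i := (Cylinder.inl F.toFunctor).toCatHom
        p := (Cylinder.π F.toFunctor).toCatHom
        fac := rfl
        hi := Cylinder.injectiveOnObjects_inl _
        hp := Cylinder.surjectiveEquivalences_π _ }⟩

/-- Lifting `i` against its own cylinder projection factors the inclusion `Cylinder.inl` through
`i`, which makes `i` injective on objects. -/
lemma surjectiveEquivalences_llp : surjectiveEquivalences.{u}.llp = injectiveOnObjects := by
  apply le_antisymm
  · intro A B i hi
    have sq : CommSq (Cylinder.inl i.toFunctor).toCatHom i (Cylinder.π i.toFunctor).toCatHom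
      (𝟙 B) := ⟨rfl⟩
    have : sq.HasLift := (hi _ (Cylinder.surjectiveEquivalences_π _)).sq_hasLift sq
    intro x y h
    have h₁ (x : A) : sq.lift.toFunctor.obj (i.toFunctor.obj x) =
        (Cylinder.inl i.toFunctor).obj x :=
      Functor.congr_obj (congr_arg Cat.Hom.toFunctor sq.fac_left) x
    apply Cylinder.injectiveOnObjects_inl i.toFunctor
    exact (h₁ x).symm.trans ((congr_arg _ h).trans (h₁ y))
  · exact fun A B i hi X Y p hp ↦ hasLiftingProperty_of_surjectiveEquivalences hi hp

/-! ### Classes of morphisms between countable categories -/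

/-- The type of morphisms satisfying a property between chosen representatives of the
isomorphism classes of countable categories. -/
abbrev CountableGenerator (P : MorphismProperty Cat.{u, u}) : Type u :=
  { i : Σ (S T : SmallCategoryCardinalLT (Cardinal.aleph.{u} 1)),
        Cat.of (SmallCategoryCardinalLT.categoryFamily _ S) ⟶
          Cat.of (SmallCategoryCardinalLT.categoryFamily _ T) // P i.2.2 }

/-- The morphisms satisfying a property between chosen representatives of the isomorphism
classes of countable categories. -/
def countableGenerators (P : MorphismProperty Cat.{u, u}) : MorphismProperty Cat.{u, u} :=
  MorphismProperty.ofHoms (fun (i : CountableGenerator P) ↦ i.1.2.2)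

instance (P : MorphismProperty Cat.{u, u}) :
    MorphismProperty.IsSmall.{u} (countableGenerators P) := by
  dsimp only [countableGenerators]
  infer_instance

instance (P : MorphismProperty Cat.{u, u}) :
    MorphismProperty.HasSmallObjectArgument.{u} (countableGenerators P) :=
  hasSmallObjectArgument_of_isLocallyPresentable _

lemma countableGenerators_le (P : MorphismProperty Cat.{u, u}) : countableGenerators P ≤ P := by
  rintro _ _ _ ⟨i⟩
  exact i.2

/-- The arrows embed into the ordinal of ℵ₁, and the objects do so through their identities; the
category structure is transported to the images. Cardinality below ℵ₁ means countable. -/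
lemma exists_iso_categoryFamily (C : Cat.{u, u}) [Countable (Arrow C)] :
    ∃ (S : SmallCategoryCardinalLT (Cardinal.aleph.{u} 1)),
      Nonempty (Cat.of (SmallCategoryCardinalLT.categoryFamily _ S) ≅ C) := by
  let κ := Cardinal.aleph.{u} 1
  have hC : HasCardinalLT (Arrow C) κ := by
    rw [hasCardinalLT_iff_cardinal_mk_lt]
    exact lt_of_le_of_lt (Cardinal.mk_le_aleph0_iff.2 inferInstance) Cardinal.aleph0_lt_aleph_one
  have ι : Arrow C ↪ κ.ord.ToType := Nonempty.some (by
    rw [← Cardinal.lift_mk_le']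
    simpa using hC.le)
  let f₁ : C ↪ κ.ord.ToType :=
    { toFun X := ι (Arrow.mk (𝟙 X))
      inj' X Y h := congr_arg Arrow.leftFunc.obj (ι.injective h) }
  let f₂ (X Y : C) : (X ⟶ Y) ↪ κ.ord.ToType :=
    { toFun f := ι (Arrow.mk f)
      inj' f g h := Arrow.mk_injective _ _ (ι.injective h) }
  let e := Equiv.ofInjective _ f₁.injective
  let h : CoreSmallCategoryOfSet κ.ord.ToType C :=
    { obj := Set.range f₁
      hom X Y := Set.range (f₂ (e.symm X) (e.symm Y))
      objEquiv := e.symm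
      homEquiv {X Y} := (Equiv.ofInjective _ (f₂ _ _).injective).symm }
  have : h.functor.IsIso := { bijective_obj := h.objEquiv.bijective }
  have : IsIso (Y := C) h.functor.toCatHom := by
    apply +allowSynthFailures isIso_of_functorIsIso
    exact this
  exact ⟨⟨h.smallCategoryOfSet, by rwa [hasCardinalLT_iff_of_equiv h.arrowEquiv]⟩,
    ⟨asIso (Y := C) h.functor.toCatHom⟩⟩

lemma hasLiftingProperty_of_countable {P : MorphismProperty Cat.{u, u}} [P.RespectsIso]
    {A B : Cat.{u, u}} [Countable (Arrow A)] [Countable (Arrow B)] {i : A ⟶ B} (hi : P i)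
    {X Y : Cat.{u, u}} {p : X ⟶ Y} (hp : (countableGenerators P).rlp p) :
    HasLiftingProperty i p := by
  obtain ⟨S, ⟨e⟩⟩ := exists_iso_categoryFamily A
  obtain ⟨T, ⟨e'⟩⟩ := exists_iso_categoryFamily B
  let i' := e.hom ≫ i ≫ e'.inv
  let E : Arrow.mk i' ≅ Arrow.mk i := Arrow.isoMk e e' (by simp [i'])
  have hi' : P i' := (P.arrow_mk_iso_iff E).2 hi
  let g : CountableGenerator P := ⟨⟨S, T, i'⟩, hi'⟩
  have : HasLiftingProperty i' p :=
    hp i' (MorphismProperty.ofHoms.mk (f := fun (i : CountableGenerator P) ↦ i.1.2.2) g)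
  exact HasLiftingProperty.of_arrow_iso_left E p

instance : (injectiveOnObjects.{u}).RespectsIso := by
  rw [← surjectiveEquivalences_llp]
  infer_instance

instance : (groupoidalEquivalences.{u}).RespectsIso :=
  MorphismProperty.respectsIso_of_isStableUnderComposition (by
    intro A B F (_ : IsIso F)
    have : F.toFunctor.IsEquivalence := (Cat.equivOfIso (asIso F)).isEquivalence_functor
    exact groupoidalEquivalences_of_isEquivalence F.toFunctor)

lemma countable_arrow {C : Type u} [Category.{u} C] [Countable C]
    [∀ (X Y : C), Countable (X ⟶ Y)] : Countable (Arrow C) := by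
  have : Function.Surjective
      (fun (x : Σ (p : C × C), (p.1 ⟶ p.2)) ↦ Arrow.mk x.2) := by
    rintro ⟨X, Y, f⟩
    exact ⟨⟨⟨X, Y⟩, f⟩, rfl⟩
  exact this.countable

instance (C : Type u) [Preorder C] [Countable C] : Countable (Arrow C) :=
  countable_arrow

/-! ### Separating morphisms by functors to groups -/

/-- The unique object of the groupoid attached to a group. -/
structure Delooping (G : Type u) : Type u where

instance (G : Type u) [Group G] : Groupoid.{u} (Delooping G) where
  Hom _ _ := G
  id _ := (1 : G)
  comp f g := (f * g : G)
  id_comp := one_mul (M := G)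
  comp_id := mul_one (M := G)
  assoc := mul_assoc (G := G)
  inv f := (f⁻¹ : G)
  inv_comp := inv_mul_cancel (G := G)
  comp_inv := mul_inv_cancel (G := G)

/-- Choose a morphism from `x` to every object of its component. Conjugation by these turns
morphisms of the component into loops at `x`, injectively on each hom-set; morphisms of other
components go to the identity. -/
lemma CategoryTheory.Groupoid.exists_functor_delooping_ne {Z : Type u} [Groupoid.{u} Z] {x y : Z}
    {f g : x ⟶ y} (hfg : f ≠ g) :
    ∃ (G : Type u) (_ : Group G) (H : Z ⥤ Delooping G), H.map f ≠ H.map g := by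
  classical
  let t (z : Z) (hz : Nonempty (x ⟶ z)) : x ⟶ z := Classical.choice hz
  have ht (a b : Z) (k : a ⟶ b) : Nonempty (x ⟶ a) ↔ Nonempty (x ⟶ b) :=
    ⟨fun ⟨s⟩ ↦ ⟨s ≫ k⟩, fun ⟨s⟩ ↦ ⟨s ≫ Groupoid.inv k⟩⟩
  let m {a b : Z} (k : a ⟶ b) : x ⟶ x :=
    if h : Nonempty (x ⟶ a) ∧ Nonempty (x ⟶ b) then t a h.1 ≫ k ≫ Groupoid.inv (t b h.2)
    else 𝟙 x
  let _ := Groupoid.vertexGroup x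
  let H : Z ⥤ Delooping (x ⟶ x) :=
    { obj _ := ⟨⟩
      map k := m k
      map_id a := by
        change m (𝟙 a) = 𝟙 x
        dsimp only [m]
        split_ifs <;> simp
      map_comp {a b c} k l := by
        change m (k ≫ l) = m k ≫ m l
        dsimp only [m]
        by_cases ha : Nonempty (x ⟶ a)
        · have hb := (ht a b k).1 ha
          have hc := (ht b c l).1 hb
          simp [ha, hb, hc]
        · have hb := (ht a b k).not.1 ha
          simp [ha, hb] }
  refine ⟨x ⟶ x, inferInstance, H, fun h ↦ hfg ?_⟩
  have hx : Nonempty (x ⟶ x) := ⟨𝟙 x⟩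
  have hy : Nonempty (x ⟶ y) := ⟨f⟩
  have : m f = m g := h
  dsimp only [m] at this
  rw [dif_pos ⟨hx, hy⟩, dif_pos ⟨hx, hy⟩, cancel_epi, cancel_mono] at this
  exact this

/-! ### Countable subcategories -/

/-- A set of morphisms of a category which contains the identities of the sources and of the
targets of its elements, and which is closed under composition. -/
structure ArrowSubcategory (E : Type u) [Category.{v} E] where
  /-- the set of morphisms -/
  carrier : Set (Arrow E)
  id_left_mem {x y : E} {f : x ⟶ y} : Arrow.mk f ∈ carrier → Arrow.mk (𝟙 x) ∈ carrier
  id_right_mem {x y : E} {f : x ⟶ y} : Arrow.mk f ∈ carrier → Arrow.mk (𝟙 y) ∈ carrier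
  comp_mem {x y z : E} {f : x ⟶ y} {g : y ⟶ z} : Arrow.mk f ∈ carrier → Arrow.mk g ∈ carrier →
    Arrow.mk (f ≫ g) ∈ carrier

namespace ArrowSubcategory

section

variable {E : Type u} [Category.{v} E] (S : ArrowSubcategory E)

/-- The objects of a subcategory. -/
structure Obj where
  /-- the underlying object -/
  as : E
  id_mem : Arrow.mk (𝟙 as) ∈ S.carrier

instance : Category.{v} S.Obj where
  Hom x y := { f : x.as ⟶ y.as // Arrow.mk f ∈ S.carrier }
  id x := ⟨𝟙 x.as, x.id_mem⟩
  comp f g := ⟨f.1 ≫ g.1, S.comp_mem f.2 g.2⟩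

/-- The inclusion of a subcategory. -/
def ι : S.Obj ⥤ E where
  obj x := x.as
  map f := f.1
  map_id _ := rfl
  map_comp _ _ := rfl

lemma countable_arrow_obj (hS : S.carrier.Countable) : Countable (Arrow S.Obj) := by
  have := hS.to_subtype
  have : Function.Injective (fun (f : Arrow S.Obj) ↦ (⟨Arrow.mk f.hom.1, f.hom.2⟩ : S.carrier)) := by
    rintro ⟨⟨x, hx⟩, ⟨y, hy⟩, f, hf⟩ ⟨⟨x', hx'⟩, ⟨y', hy'⟩, f', hf'⟩ h
    have h : Arrow.mk f = Arrow.mk f' := congr_arg Subtype.val h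
    obtain rfl : x = x' := congr_arg (fun (g : Arrow E) ↦ g.left) h
    obtain rfl : y = y' := congr_arg (fun (g : Arrow E) ↦ g.right) h
    obtain rfl := Arrow.mk_injective _ _ h
    rfl
  exact this.countable

/-- The composition of morphisms of a category, extended to all pairs of morphisms. -/
noncomputable def totalComp (f g : Arrow E) : Arrow E := by
  classical
  exact if h : f.right = g.left then Arrow.mk (f.hom ≫ eqToHom h ≫ g.hom) else f

lemma totalComp_mk {x y z : E} (f : x ⟶ y) (g : y ⟶ z) :
    totalComp (Arrow.mk f) (Arrow.mk g) = Arrow.mk (f ≫ g) := by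
  simp [totalComp]

/-- The composites of at most `2 ^ n` morphisms in a set. -/
def composites (T : Set (Arrow E)) : ℕ → Set (Arrow E)
  | 0 => T
  | n + 1 => composites T n ∪ Set.image2 totalComp (composites T n) (composites T n)

lemma composites_monotone (T : Set (Arrow E)) : Monotone (composites T) :=
  monotone_nat_of_le_succ (fun _ ↦ Set.subset_union_left)

lemma countable_composites {T : Set (Arrow E)} (hT : T.Countable) (n : ℕ) :
    (composites T n).Countable := by
  induction n with
  | zero => exact hT
  | succ n hn => exact hn.union (hn.image2 hn _)

lemma totalComp_ids (f g : Arrow E) :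
    (totalComp f g).left = f.left ∧
      ((totalComp f g).right = f.right ∨ (totalComp f g).right = g.right) := by
  dsimp only [totalComp]
  split_ifs
  · exact ⟨rfl, Or.inr rfl⟩
  · exact ⟨rfl, Or.inl rfl⟩

lemma exists_countable (T : Set (Arrow E)) (hT : T.Countable) :
    ∃ (S : ArrowSubcategory E), T ⊆ S.carrier ∧ S.carrier.Countable := by
  -- Identities need only be added at the start, since composition creates no new endpoints.
  let T' : Set (Arrow E) := T ∪ ((fun f ↦ Arrow.mk (𝟙 f.left)) '' T) ∪
    ((fun f ↦ Arrow.mk (𝟙 f.right)) '' T)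
  have hT' : T'.Countable := (hT.union (hT.image _)).union (hT.image _)
  have hids (n : ℕ) (f : Arrow E) (hf : f ∈ composites T' n) :
      Arrow.mk (𝟙 f.left) ∈ T' ∧ Arrow.mk (𝟙 f.right) ∈ T' := by
    induction n generalizing f with
    | zero =>
      obtain (hf | ⟨g, hg, rfl⟩) | ⟨g, hg, rfl⟩ := hf
      · exact ⟨Or.inl (Or.inr ⟨f, hf, rfl⟩), Or.inr ⟨f, hf, rfl⟩⟩
      · exact ⟨Or.inl (Or.inr ⟨g, hg, rfl⟩), Or.inl (Or.inr ⟨g, hg, rfl⟩)⟩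
      · exact ⟨Or.inr ⟨g, hg, rfl⟩, Or.inr ⟨g, hg, rfl⟩⟩
    | succ n hn =>
      obtain hf | ⟨g, hg, h, hh, rfl⟩ := hf
      · exact hn f hf
      · obtain ⟨h₁, h₂⟩ := totalComp_ids g h
        rw [h₁]
        refine ⟨(hn g hg).1, ?_⟩
        obtain h₂ | h₂ := h₂ <;> rw [h₂]
        exacts [(hn g hg).2, (hn h hh).2]
  refine ⟨{ carrier := ⋃ n, composites T' n
            id_left_mem := ?_
            id_right_mem := ?_
            comp_mem := ?_ }, fun f hf ↦ ?_, Set.countable_iUnion (countable_composites hT')⟩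
  · intro x y f hf
    obtain ⟨n, hf⟩ := Set.mem_iUnion.1 hf
    exact Set.mem_iUnion.2 ⟨0, (hids n _ hf).1⟩
  · intro x y f hf
    obtain ⟨n, hf⟩ := Set.mem_iUnion.1 hf
    exact Set.mem_iUnion.2 ⟨0, (hids n _ hf).2⟩
  · intro x y z f g hf hg
    obtain ⟨n, hf⟩ := Set.mem_iUnion.1 hf
    obtain ⟨m, hg⟩ := Set.mem_iUnion.1 hg
    refine Set.mem_iUnion.2 ⟨max n m + 1, Or.inr ?_⟩
    rw [← totalComp_mk]
    exact Set.mem_image2_of_mem (composites_monotone _ (le_max_left _ _) hf)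
      (composites_monotone _ (le_max_right _ _) hg)
  · exact Set.mem_iUnion.2 ⟨0, Or.inl (Or.inl hf)⟩

end

/-! ### Equality of morphisms in all groupoids -/

section

variable {E : Type u} [Category.{u} E]

/-- The condition that a map from the morphisms of a category to a group is compatible with those
compositions which involve only morphisms in a given set. -/
def IsMultiplicativeOn (S : Set (Arrow E)) {G : Type u} [Group G] (k : Arrow E → G) : Prop :=
  ∀ ⦃x y z : E⦄ (f : x ⟶ y) (g : y ⟶ z), Arrow.mk f ∈ S → Arrow.mk g ∈ S →
    Arrow.mk (f ≫ g) ∈ S → k (Arrow.mk (f ≫ g)) = k (Arrow.mk f) * k (Arrow.mk g)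

variable (E) in
/-- The words in the morphisms of a category which become trivial in all groups because of
countably many compositions. -/
def trivialWords : Subgroup (FreeGroup (Arrow E)) where
  carrier := { x | ∃ (S : Set (Arrow E)), S.Countable ∧ ∀ (G : Type u) [Group G] (k : Arrow E → G),
    IsMultiplicativeOn S k → FreeGroup.lift k x = 1 }
  one_mem' := ⟨∅, Set.countable_empty, fun G _ k hk ↦ by simp⟩
  mul_mem' := by
    rintro x y ⟨S, hS, hx⟩ ⟨T, hT, hy⟩
    refine ⟨S ∪ T, hS.union hT, fun G _ k hk ↦ ?_⟩
    rw [map_mul, hx G k (fun _ _ _ f g hf hg hfg ↦ hk f g (Or.inl hf) (Or.inl hg) (Or.inl hfg)),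
      hy G k (fun _ _ _ f g hf hg hfg ↦ hk f g (Or.inr hf) (Or.inr hg) (Or.inr hfg)), one_mul]
  inv_mem' := by
    rintro x ⟨S, hS, hx⟩
    refine ⟨S, hS, fun G _ k hk ↦ by rw [map_inv, hx G k hk, inv_one]⟩

instance : (trivialWords E).Normal where
  conj_mem := by
    rintro x ⟨S, hS, hx⟩ y
    refine ⟨S, hS, fun G _ k hk ↦ by simp [hx G k hk]⟩

variable (E) in
/-- The functor from a category to the group of its morphisms, modulo trivial words. -/
def toWords : E ⥤ Delooping (FreeGroup (Arrow E) ⧸ trivialWords E) where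
  obj _ := ⟨⟩
  map f := (QuotientGroup.mk (FreeGroup.of (Arrow.mk f)) : FreeGroup (Arrow E) ⧸ trivialWords E)
  map_id x := by
    refine (QuotientGroup.eq_one_iff _).2 ?_
    refine ⟨{Arrow.mk (𝟙 x)}, Set.countable_singleton _, fun G _ k hk ↦ ?_⟩
    have := hk (𝟙 x) (𝟙 x) (by simp) (by simp) (by simp)
    simpa using this
  map_comp f g := by
    refine QuotientGroup.eq.2 ?_
    refine ⟨{Arrow.mk f, Arrow.mk g, Arrow.mk (f ≫ g)}, Set.Finite.countable (by simp),
      fun G _ k hk ↦ ?_⟩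
    have := hk f g (by simp) (by simp) (by simp)
    rw [map_mul, map_mul, map_inv, inv_mul_eq_one]
    simpa using this

/-- If two morphisms become equal in all groupoids, this is already so in a countable
subcategory. -/
lemma exists_countable_of_map_eq {x y : E} (φ φ' : x ⟶ y)
    (h : ∀ (Z : Type u) [Groupoid.{u} Z] (K : E ⥤ Z), K.map φ = K.map φ') :
    ∃ (S : ArrowSubcategory E) (a b : S.Obj) (ψ ψ' : a ⟶ b), S.carrier.Countable ∧
      Arrow.mk (S.ι.map ψ) = Arrow.mk φ ∧ Arrow.mk (S.ι.map ψ') = Arrow.mk φ' ∧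
        ∀ (Z : Type u) [Groupoid.{u} Z] (K : S.Obj ⥤ Z), K.map ψ = K.map ψ' := by
  obtain ⟨T, hT, hT'⟩ := QuotientGroup.eq.1
    (show (QuotientGroup.mk (FreeGroup.of (Arrow.mk φ)) : FreeGroup (Arrow E) ⧸ trivialWords E) =
      QuotientGroup.mk (FreeGroup.of (Arrow.mk φ')) from
      h (Delooping (FreeGroup (Arrow E) ⧸ trivialWords E)) (toWords E))
  -- `T` records the countably many compositions that force equality in all groups, so any
  -- subcategory containing it forces the same equality.
  obtain ⟨S, hTS, hS⟩ := exists_countable (T ∪ {Arrow.mk φ, Arrow.mk φ'})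
    (hT.union (Set.Finite.countable (by simp)))
  have hφ : Arrow.mk φ ∈ S.carrier := hTS (by simp)
  have hφ' : Arrow.mk φ' ∈ S.carrier := hTS (by simp)
  let a : S.Obj := ⟨x, S.id_left_mem hφ⟩
  let b : S.Obj := ⟨y, S.id_right_mem hφ⟩
  let ψ : a ⟶ b := ⟨φ, hφ⟩
  let ψ' : a ⟶ b := ⟨φ', hφ'⟩
  refine ⟨S, a, b, ψ, ψ', hS, rfl, rfl, fun Z _ K ↦ ?_⟩
  by_contra! hK
  obtain ⟨G, _, H, hH⟩ := Groupoid.exists_functor_delooping_ne hK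
  classical
  -- Extending by 1 outside the subcategory is harmless: multiplicativity is only required on `T`,
  -- which lies inside it.
  let k (f : Arrow E) : G := if hf : f ∈ S.carrier then
      (K ⋙ H).map (X := ⟨f.left, S.id_left_mem hf⟩) (Y := ⟨f.right, S.id_right_mem hf⟩) ⟨f.hom, hf⟩
    else 1
  have hk {c d : S.Obj} (f : c ⟶ d) : k (Arrow.mk f.1) = (K ⋙ H).map f := dif_pos f.2
  have := hT' G k (by
    intro c d e f g hf hg hfg
    have hf' := hTS (Or.inl hf)
    have hg' := hTS (Or.inl hg)
    let f' : (⟨c, S.id_left_mem hf'⟩ : S.Obj) ⟶ ⟨d, S.id_left_mem hg'⟩ := ⟨f, hf'⟩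
    let g' : (⟨d, S.id_left_mem hg'⟩ : S.Obj) ⟶ ⟨e, S.id_right_mem hg'⟩ := ⟨g, hg'⟩
    change k (Arrow.mk (f' ≫ g').1) = k (Arrow.mk f'.1) * k (Arrow.mk g'.1)
    rw [hk, hk, hk, Functor.map_comp]
    rfl)
  rw [map_mul, map_inv, inv_mul_eq_one, FreeGroup.lift_apply_of, FreeGroup.lift_apply_of] at this
  exact hH ((hk ψ).symm.trans (this.trans (hk ψ')))

end

end ArrowSubcategory

/-! ### Faithfulness from lifting properties -/

section

variable {E B : Cat.{u, u}} {p : E ⟶ B}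

/-- The relation which identifies two given parallel morphisms. -/
inductive IdentifyRel {A : Type u} [Category.{u} A] {a b : A} (ψ ψ' : a ⟶ b) : HomRel A
  | mk : IdentifyRel ψ ψ' ψ ψ'

/-- `F` followed by `p` descends to the quotient identifying the two morphisms; a lift factors `F`
itself through that quotient. -/
lemma map_eq_map_of_hasLiftingProperty {A : Type u} [Category.{u} A] {a b : A} (ψ ψ' : a ⟶ b)
    (hp : HasLiftingProperty (Quotient.functor (IdentifyRel ψ ψ')).toCatHom p) (F : A ⥤ E)
    (h : p.toFunctor.map (F.map ψ) = p.toFunctor.map (F.map ψ')) : F.map ψ = F.map ψ' := by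
  have hF (x y : A) (f g : x ⟶ y) (hfg : IdentifyRel ψ ψ' f g) :
      (F ⋙ p.toFunctor).map f = (F ⋙ p.toFunctor).map g := by
    obtain ⟨⟩ := hfg
    exact h
  let L : CategoryTheory.Quotient (IdentifyRel ψ ψ') ⥤ B :=
    CategoryTheory.Quotient.lift _ (F ⋙ p.toFunctor) hF
  have sq : CommSq F.toCatHom (Quotient.functor (IdentifyRel ψ ψ')).toCatHom p L.toCatHom := ⟨by
    apply Cat.Hom.ext
    exact (CategoryTheory.Quotient.lift_spec _ (F ⋙ p.toFunctor) hF).symm⟩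
  have : sq.HasLift := hp.sq_hasLift sq
  have hl : Quotient.functor (IdentifyRel ψ ψ') ⋙ sq.lift.toFunctor = F :=
    congr_arg Cat.Hom.toFunctor sq.fac_left
  rw [← hl]
  exact congr_arg sq.lift.toFunctor.map (CategoryTheory.Quotient.sound _ (.mk))

instance countable_arrow_quotient {A : Type u} [Category.{u} A] [Countable (Arrow A)]
    (r : HomRel A) : Countable (Arrow (CategoryTheory.Quotient r)) := by
  have : Function.Surjective (Quotient.functor r).mapArrow.obj := by
    rintro ⟨⟨x⟩, ⟨y⟩, f⟩
    obtain ⟨f, rfl⟩ := (Quotient.functor r).map_surjective f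
    exact ⟨Arrow.mk f, rfl⟩
  exact this.countable

lemma faithful_of_countableGenerators_injectiveOnObjects_rlp
    (hp : (countableGenerators injectiveOnObjects).rlp p) : p.toFunctor.Faithful where
  map_injective {x y φ φ'} h := by
    obtain ⟨S, hS, hS'⟩ := ArrowSubcategory.exists_countable {Arrow.mk φ, Arrow.mk φ'}
      (Set.Finite.countable (by simp))
    have hφ : Arrow.mk φ ∈ S.carrier := hS (by simp)
    have hφ' : Arrow.mk φ' ∈ S.carrier := hS (by simp)
    let a : S.Obj := ⟨x, S.id_left_mem hφ⟩
    let b : S.Obj := ⟨y, S.id_right_mem hφ⟩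
    let ψ : a ⟶ b := ⟨φ, hφ⟩
    let ψ' : a ⟶ b := ⟨φ', hφ'⟩
    have : Countable (Arrow S.Obj) := S.countable_arrow_obj hS'
    have : Countable (Arrow (Cat.of S.Obj)) := this
    have : Countable (Arrow (Cat.of (CategoryTheory.Quotient (IdentifyRel ψ ψ')))) :=
      countable_arrow_quotient (A := S.Obj) _
    exact map_eq_map_of_hasLiftingProperty ψ ψ' (hasLiftingProperty_of_countable
      (fun x y h ↦ congr_arg Quotient.as h) hp) S.ι h

/-- Every functor from `E` to a groupoid is isomorphic to one that factors through `p`, so morphisms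
identified by `p` agree in all groupoids. A countable subcategory already forces this, and there the
quotient is a trivial cofibration. -/
lemma faithful_of_countableGenerators_rlp
    (hp : (countableGenerators (injectiveOnObjects ⊓ groupoidalEquivalences)).rlp p)
    (hp' : groupoidalEquivalences p) : p.toFunctor.Faithful where
  map_injective {x y φ φ'} h := by
    obtain ⟨S, a, b, ψ, ψ', hS, h₁, h₂, h₃⟩ := ArrowSubcategory.exists_countable_of_map_eq φ φ' (by
      intro Z _ K
      have := hp' Z
      let e : p.toFunctor ⋙ _ ≅ K :=
        ((Functor.whiskeringLeft E B Z).obj p.toFunctor).objObjPreimageIso K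
      rw [← cancel_epi (e.hom.app x), ← e.hom.naturality, ← e.hom.naturality, Functor.comp_map,
        Functor.comp_map, h])
    have : Countable (Arrow S.Obj) := S.countable_arrow_obj hS
    have : Countable (Arrow (Cat.of S.Obj)) := this
    have : Countable (Arrow (Cat.of (CategoryTheory.Quotient (IdentifyRel ψ ψ')))) :=
      countable_arrow_quotient (A := S.Obj) _
    have key := map_eq_map_of_hasLiftingProperty ψ ψ' (hasLiftingProperty_of_countable
      (groupoidalEquivalences_quotient _ (by rintro Z _ K _ _ _ _ ⟨⟩; exact h₃ Z K)) hp) S.ι (by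
        apply Arrow.mk_injective
        have h' : p.toFunctor.mapArrow.obj (Arrow.mk φ) = p.toFunctor.mapArrow.obj (Arrow.mk φ') :=
          congr_arg Arrow.mk h
        rw [← h₁, ← h₂] at h'
        exact h')
    apply Arrow.mk_injective
    rw [← h₁, ← h₂, key]

end

/-! ### Categories with an initial or terminal object -/

lemma groupoidalEquivalences_toPoint_of_isTerminal {C : Cat.{u, u}} {t : C} (ht : IsTerminal t) :
    groupoidalEquivalences (toPoint C) :=
  groupoidalEquivalences_of_leftAdjoint (F := (toPoint C).toFunctor) (G := Functor.fromPUnit t)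
    (Adjunction.mkOfUnitCounit
      { unit := { app x := ht.from x
                  naturality _ _ _ := ht.hom_ext _ _ }
        counit := { app x := 𝟙 _ }
        left_triangle := by ext; exact Subsingleton.elim (α := Discrete.mk _ ⟶ Discrete.mk _) _ _
        right_triangle := by ext; exact ht.hom_ext _ _ })

lemma groupoidalEquivalences_toPoint_of_isInitial {C : Cat.{u, u}} {t : C} (ht : IsInitial t) :
    groupoidalEquivalences (toPoint C) :=
  groupoidalEquivalences_of_rightAdjoint (G := (toPoint C).toFunctor) (F := Functor.fromPUnit t)
    (Adjunction.mkOfUnitCounit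
      { counit := { app x := ht.to x
                    naturality _ _ _ := ht.hom_ext _ _ }
        unit := { app x := 𝟙 _ }
        right_triangle := by ext; exact Subsingleton.elim (α := Discrete.mk _ ⟶ Discrete.mk _) _ _
        left_triangle := by ext; exact ht.hom_ext _ _ })

lemma groupoidalEquivalences_of_toPoint {C D : Cat.{u, u}} (i : C ⟶ D)
    (hC : groupoidalEquivalences (toPoint C)) (hD : groupoidalEquivalences (toPoint D)) :
    groupoidalEquivalences i :=
  groupoidalEquivalences.of_postcomp i (toPoint D) hD hC

namespace CategoryTheory.AsSmall

variable {C : Type} [SmallCategory C]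

instance [Countable C] [∀ (X Y : C), Countable (X ⟶ Y)] : Countable (Arrow (AsSmall.{u} C)) := by
  have : Countable (AsSmall.{u} C) := inferInstanceAs (Countable (ULift C))
  have (X Y : AsSmall.{u} C) : Countable (X ⟶ Y) :=
    inferInstanceAs (Countable (ULift (AsSmall.down.obj X ⟶ AsSmall.down.obj Y)))
  exact countable_arrow

lemma toPoint_of_isTerminal {t : C} (ht : IsTerminal t) :
    groupoidalEquivalences (toPoint (Cat.of (AsSmall.{u} C))) :=
  groupoidalEquivalences_toPoint_of_isTerminal (t := AsSmall.up.obj t)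
    (IsTerminal.isTerminalObj AsSmall.equiv.functor t ht)

lemma toPoint_of_isInitial {t : C} (ht : IsInitial t) :
    groupoidalEquivalences (toPoint (Cat.of (AsSmall.{u} C))) :=
  groupoidalEquivalences_toPoint_of_isInitial (t := AsSmall.up.obj t)
    (IsInitial.isInitialObj AsSmall.equiv.functor t ht)

end CategoryTheory.AsSmall

instance (x y : WalkingCospan) : Countable (x ⟶ y) := Finite.to_countable
instance (x y : WalkingSpan) : Countable (x ⟶ y) := Finite.to_countable

/-! ### Lifting morphisms -/

/-- A morphism in the target of a functor lifts to a morphism between given objects. -/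
def LiftsTo {E B : Type u} [Category.{u} E] [Category.{u} B] (p : E ⥤ B) {b b' : B} (f : b ⟶ b')
    (e e' : E) : Prop :=
  ∃ (φ : Arrow E), φ.left = e ∧ φ.right = e' ∧ p.mapArrow.obj φ = Arrow.mk f

namespace LiftsTo

section

variable {E B : Type u} [Category.{u} E] [Category.{u} B] {p : E ⥤ B}

lemma id {b : B} {e : E} (h : p.obj e = b) : LiftsTo p (𝟙 b) e e := by
  subst h
  exact ⟨Arrow.mk (𝟙 e), rfl, rfl, by simp⟩

lemma map {e e' : E} (φ : e ⟶ e') : LiftsTo p (p.map φ) e e' :=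
  ⟨Arrow.mk φ, rfl, rfl, rfl⟩

lemma obj_left {b b' : B} {f : b ⟶ b'} {e e' : E} (h : LiftsTo p f e e') : p.obj e = b := by
  obtain ⟨φ, rfl, rfl, h⟩ := h
  exact congr_arg (fun (g : Arrow B) ↦ g.left) h

lemma obj_right {b b' : B} {f : b ⟶ b'} {e e' : E} (h : LiftsTo p f e e') : p.obj e' = b' := by
  obtain ⟨φ, rfl, rfl, h⟩ := h
  exact congr_arg (fun (g : Arrow B) ↦ g.right) h

lemma exists_map_eq {e e' : E} {f : p.obj e ⟶ p.obj e'} (h : LiftsTo p f e e') :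
    ∃ (φ : e ⟶ e'), p.map φ = f := by
  obtain ⟨φ, rfl, rfl, h⟩ := h
  exact ⟨φ.hom, Arrow.mk_injective _ _ h⟩

lemma comp {b b' b'' : B} {f : b ⟶ b'} {g : b' ⟶ b''} {e e' e'' : E} (hf : LiftsTo p f e e')
    (hg : LiftsTo p g e' e'') : LiftsTo p (f ≫ g) e e'' := by
  obtain rfl := hf.obj_left
  obtain rfl := hf.obj_right
  obtain rfl := hg.obj_right
  obtain ⟨φ, rfl⟩ := hf.exists_map_eq
  obtain ⟨ψ, rfl⟩ := hg.exists_map_eq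
  rw [← p.map_comp]
  exact map _

end

section

variable {E B : Cat.{u, u}} {p : E ⟶ B}

/-- By two-out-of-three, any functor between categories groupoidally equivalent to the point is a
groupoidal equivalence. `AsSmall` brings countable shapes to the right universe. -/
lemma _root_.exists_lift_of_asSmall {X Y : Type} [SmallCategory X] [SmallCategory Y]
    [Countable X] [Countable Y] [∀ (x x' : X), Countable (x ⟶ x')]
    [∀ (y y' : Y), Countable (y ⟶ y')]
    (hX : groupoidalEquivalences (toPoint (Cat.of (AsSmall.{u} X))))
    (hY : groupoidalEquivalences (toPoint (Cat.of (AsSmall.{u} Y))))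
    (hp : (countableGenerators (injectiveOnObjects ⊓ groupoidalEquivalences)).rlp p)
    (i : X ⥤ Y) (hi : Function.Injective i.obj) (F : X ⥤ E) (G : Y ⥤ B)
    (w : F ⋙ p.toFunctor = i ⋙ G) : ∃ (L : Y ⥤ E), i ⋙ L = F ∧ L ⋙ p.toFunctor = G := by
  let i' : AsSmall.{u} X ⥤ AsSmall.{u} Y := AsSmall.down ⋙ i ⋙ AsSmall.up
  have : Countable (Arrow (Cat.of (AsSmall.{u} X))) :=
    inferInstanceAs (Countable (Arrow (AsSmall X)))
  have : Countable (Arrow (Cat.of (AsSmall.{u} Y))) :=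
    inferInstanceAs (Countable (Arrow (AsSmall Y)))
  have h : HasLiftingProperty i'.toCatHom p := hasLiftingProperty_of_countable (by
    refine ⟨fun x x' h ↦ ?_, groupoidalEquivalences_of_toPoint _ hX hY⟩
    exact ULift.down_injective (hi (ULift.up_injective h))) hp
  have sq : CommSq (AsSmall.down ⋙ F).toCatHom i'.toCatHom p (AsSmall.down ⋙ G).toCatHom :=
    ⟨Cat.Hom.ext (congr_arg (fun H ↦ AsSmall.down ⋙ H) w)⟩
  have : sq.HasLift := h.sq_hasLift sq
  exact ⟨AsSmall.up ⋙ sq.lift.toFunctor,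
    congr_arg (fun (H : Cat.of (AsSmall X) ⟶ E) ↦ AsSmall.up ⋙ H.toFunctor) sq.fac_left,
    congr_arg (fun (H : Cat.of (AsSmall Y) ⟶ B) ↦ AsSmall.up ⋙ H.toFunctor) sq.fac_right⟩

variable {b b' b'' : B} {f : b ⟶ b'} {g : b' ⟶ b''} {e e' e'' : E}

/-- Lifting against {0} → [1]. -/
lemma exists_of_source (f : b ⟶ b')
    (hp : (countableGenerators (injectiveOnObjects ⊓ groupoidalEquivalences)).rlp p)
    (he : p.toFunctor.obj e = b) : ∃ e', LiftsTo p.toFunctor f e e' := by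
  subst he
  obtain ⟨L, hL, hL'⟩ := exists_lift_of_asSmall
    (AsSmall.toPoint_of_isTerminal (isTerminalTop (α := Fin 1)))
    (AsSmall.toPoint_of_isTerminal (isTerminalTop (α := Fin 2))) hp
    ((Functor.const (Fin 1)).obj (0 : Fin 2)) (Function.injective_of_subsingleton _)
    ((Functor.const _).obj e) (ComposableArrows.mk₁ f)
    (Functor.hext (fun _ ↦ rfl) (fun _ _ _ ↦ heq_of_eq
      ((p.toFunctor.map_id e).trans ((ComposableArrows.mk₁ f).map_id 0).symm)))
  exact ⟨L.obj 1, L.mapArrow.obj (Arrow.mk (homOfLE (Fin.zero_le 1))), Functor.congr_obj hL 0, rfl,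
    congr_arg (fun (F : Fin 2 ⥤ B) ↦ F.mapArrow.obj (Arrow.mk (homOfLE (Fin.zero_le 1)))) hL'⟩

lemma exists_of_target (f : b ⟶ b')
    (hp : (countableGenerators (injectiveOnObjects ⊓ groupoidalEquivalences)).rlp p)
    (he : p.toFunctor.obj e' = b') : ∃ e, LiftsTo p.toFunctor f e e' := by
  subst he
  obtain ⟨L, hL, hL'⟩ := exists_lift_of_asSmall
    (AsSmall.toPoint_of_isTerminal (isTerminalTop (α := Fin 1)))
    (AsSmall.toPoint_of_isTerminal (isTerminalTop (α := Fin 2))) hp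
    ((Functor.const (Fin 1)).obj (1 : Fin 2)) (Function.injective_of_subsingleton _)
    ((Functor.const _).obj e') (ComposableArrows.mk₁ f)
    (Functor.hext (fun _ ↦ rfl) (fun _ _ _ ↦ heq_of_eq
      ((p.toFunctor.map_id e').trans ((ComposableArrows.mk₁ f).map_id 1).symm)))
  exact ⟨L.obj 0, L.mapArrow.obj (Arrow.mk (homOfLE (Fin.zero_le 1))), rfl, Functor.congr_obj hL 0,
    congr_arg (fun (F : Fin 2 ⥤ B) ↦ F.mapArrow.obj (Arrow.mk (homOfLE (Fin.zero_le 1)))) hL'⟩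

/-- Lifting against the inclusion of the cospan 0 → 2 ← 1 in [2]; both categories have a terminal
object. -/
lemma of_comp_right
    (hp : (countableGenerators (injectiveOnObjects ⊓ groupoidalEquivalences)).rlp p)
    (h : LiftsTo p.toFunctor (f ≫ g) e e'') (h' : LiftsTo p.toFunctor g e' e'') :
    LiftsTo p.toFunctor f e e' := by
  obtain rfl := h.obj_left
  obtain rfl := h'.obj_left
  obtain rfl := h.obj_right
  obtain ⟨φ, hφ⟩ := h.exists_map_eq
  obtain ⟨ψ, hψ⟩ := h'.exists_map_eq
  obtain ⟨L, hL, hL'⟩ := exists_lift_of_asSmall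
    (AsSmall.toPoint_of_isTerminal (C := WalkingCospan) (t := .one)
      (IsTerminal.ofUniqueHom (fun | .one => 𝟙 _ | .left => WalkingCospan.Hom.inl | .right => WalkingCospan.Hom.inr)
        (fun _ _ ↦ Subsingleton.elim _ _)))
    (AsSmall.toPoint_of_isTerminal (isTerminalTop (α := Fin 3))) hp
    (cospan (X := (0 : Fin 3)) (Y := (1 : Fin 3)) (Z := (2 : Fin 3))
      (homOfLE (by decide)) (homOfLE (by decide)))
    (by rintro (_ | _ | _) (_ | _ | _) h <;> simp at h ⊢)
    (cospan φ ψ) (ComposableArrows.mk₂ f g) (Functor.hext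
      (by rintro (_ | _ | _) <;> rfl) (by
        rintro X _ (_ | _ | _)
        · refine (heq_of_eq (CategoryTheory.Functor.map_id _ X)).trans
            (HEq.trans ?_ (heq_of_eq (CategoryTheory.Functor.map_id _ X).symm))
          obtain _ | _ | _ := X <;> rfl
        · exact heq_of_eq hφ
        · exact heq_of_eq hψ))
  exact ⟨L.mapArrow.obj (Arrow.mk (homOfLE (show (0 : Fin 3) ≤ 1 by decide))),
    Functor.congr_obj hL .left, Functor.congr_obj hL .right,
    congr_arg (fun (F : Fin 3 ⥤ B) ↦ F.mapArrow.obj (Arrow.mk (homOfLE (by decide)))) hL'⟩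

/-- Lifting against the inclusion of the span 1 ← 0 → 2 in [2]; the span has an initial object. -/
lemma of_comp_left
    (hp : (countableGenerators (injectiveOnObjects ⊓ groupoidalEquivalences)).rlp p)
    (h : LiftsTo p.toFunctor (f ≫ g) e e'') (h' : LiftsTo p.toFunctor f e e') :
    LiftsTo p.toFunctor g e' e'' := by
  obtain rfl := h.obj_left
  obtain rfl := h'.obj_right
  obtain rfl := h.obj_right
  obtain ⟨φ, hφ⟩ := h.exists_map_eq
  obtain ⟨ψ, hψ⟩ := h'.exists_map_eq
  obtain ⟨L, hL, hL'⟩ := exists_lift_of_asSmall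
    (AsSmall.toPoint_of_isInitial (C := WalkingSpan) (t := .zero)
      (IsInitial.ofUniqueHom (fun | .zero => 𝟙 _ | .left => WalkingSpan.Hom.fst | .right => WalkingSpan.Hom.snd)
        (fun _ _ ↦ Subsingleton.elim _ _)))
    (AsSmall.toPoint_of_isTerminal (isTerminalTop (α := Fin 3))) hp
    (span (X := (0 : Fin 3)) (Y := (1 : Fin 3)) (Z := (2 : Fin 3))
      (homOfLE (by decide)) (homOfLE (by decide)))
    (by rintro (_ | _ | _) (_ | _ | _) h <;> simp at h ⊢)
    (span ψ φ) (ComposableArrows.mk₂ f g) (Functor.hext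
      (by rintro (_ | _ | _) <;> rfl) (by
        rintro X _ (_ | _ | _)
        · refine (heq_of_eq (CategoryTheory.Functor.map_id _ X)).trans
            (HEq.trans ?_ (heq_of_eq (CategoryTheory.Functor.map_id _ X).symm))
          obtain _ | _ | _ := X <;> rfl
        · exact heq_of_eq hψ
        · exact heq_of_eq hφ))
  exact ⟨L.mapArrow.obj (Arrow.mk (homOfLE (show (1 : Fin 3) ≤ 2 by decide))),
    Functor.congr_obj hL .left, Functor.congr_obj hL .right,
    congr_arg (fun (F : Fin 3 ⥤ B) ↦ F.mapArrow.obj (Arrow.mk (homOfLE (by decide)))) hL'⟩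

end

end LiftsTo

/-! ### Monodromy and sections -/

/-- The indices of a family of sets, as the objects of the groupoid where the morphisms are the
bijections between the members of the family. -/
structure FamilyGroupoid {β : Type u} (M : β → Type u) : Type u where
  /-- the index -/
  as : β

instance {β : Type u} (M : β → Type u) : Groupoid.{u} (FamilyGroupoid M) where
  Hom x y := M x.as ≃ M y.as
  id x := Equiv.refl (M x.as)
  comp f g := Equiv.trans f g
  inv f := Equiv.symm f
  inv_comp f := Equiv.symm_trans_self f
  comp_inv f := Equiv.self_trans_symm f

/-- The points of the members of a family of sets, as the objects of the groupoid where the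
morphisms are the pointed bijections. -/
structure PointedFamilyGroupoid {β : Type u} (M : β → Type u) : Type u where
  /-- the index -/
  as : β
  /-- the point -/
  pt : M as

instance {β : Type u} (M : β → Type u) : Groupoid.{u} (PointedFamilyGroupoid M) where
  Hom x y := { f : M x.as ≃ M y.as // f x.pt = y.pt }
  id x := ⟨Equiv.refl (M x.as), rfl⟩
  comp f g := ⟨Equiv.trans f.1 g.1, by simp [f.2, g.2]⟩
  inv f := ⟨Equiv.symm f.1, by simp [← f.2]⟩
  inv_comp f := Subtype.ext (Equiv.symm_trans_self f.1)
  comp_inv f := Subtype.ext (Equiv.self_trans_symm f.1)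

/-- The functor which forgets the points. -/
def PointedFamilyGroupoid.forget {β : Type u} (M : β → Type u) :
    PointedFamilyGroupoid M ⥤ FamilyGroupoid M where
  obj x := ⟨x.as⟩
  map f := f.1
  map_id _ := rfl
  map_comp _ _ := rfl

/-- A compatible family of points over the source of a groupoidal equivalence extends to the
target. -/
lemma exists_section_of_groupoidalEquivalences {E B : Cat.{u, u}} {p : E ⟶ B}
    (hp : groupoidalEquivalences p) (M : B → Type u) (m : ∀ {b b' : B}, (b ⟶ b') → (M b ≃ M b'))
    (m_id : ∀ b, m (𝟙 b) = Equiv.refl _)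
    (m_comp : ∀ {b b' b'' : B} (f : b ⟶ b') (g : b' ⟶ b''), m (f ≫ g) = (m f).trans (m g))
    (s : ∀ (e : E), M (p.toFunctor.obj e))
    (hs : ∀ {e e' : E} (φ : e ⟶ e'), m (p.toFunctor.map φ) (s e) = s e') :
    ∃ (t : ∀ b, M b), (∀ {b b' : B} (f : b ⟶ b'), m f (t b) = t b') ∧
      ∀ e, t (p.toFunctor.obj e) = s e := by
  -- The local system and its section over `E` are encoded as functors to small groupoids, the
  -- targets against which `p` can be tested.
  let P : B ⥤ FamilyGroupoid M :=
    { obj b := ⟨b⟩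
      map f := m f
      map_id := m_id
      map_comp := m_comp }
  let S : E ⥤ PointedFamilyGroupoid M :=
    { obj e := ⟨p.toFunctor.obj e, s e⟩
      map φ := ⟨m (p.toFunctor.map φ), hs φ⟩
      map_id e := Subtype.ext ((congr_arg (fun f ↦ m f) (p.toFunctor.map_id e)).trans (m_id _))
      map_comp f g := Subtype.ext
        ((congr_arg (fun f ↦ m f) (p.toFunctor.map_comp f g)).trans (m_comp _ _)) }
  have := hp (PointedFamilyGroupoid M)
  have := hp (FamilyGroupoid M)
  let G := ((Functor.whiskeringLeft E B (PointedFamilyGroupoid M)).obj p.toFunctor).objPreimage S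
  let α : p.toFunctor ⋙ G ≅ S :=
    ((Functor.whiskeringLeft E B (PointedFamilyGroupoid M)).obj p.toFunctor).objObjPreimageIso S
  let α' : p.toFunctor ⋙ G ⋙ PointedFamilyGroupoid.forget M ⟶ p.toFunctor ⋙ P :=
    Functor.whiskerRight α.hom (PointedFamilyGroupoid.forget M)
  -- `G` extends the section only up to isomorphism, possibly with other underlying sets. Fullness
  -- extends the comparison over `B`, and the points of `G` are carried along it to `M`.
  let δ : G ⋙ PointedFamilyGroupoid.forget M ⟶ P :=
    ((Functor.whiskeringLeft E B (FamilyGroupoid M)).obj p.toFunctor).preimage α'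
  have hδ (e : E) : δ.app (p.toFunctor.obj e) = (α.hom.app e).1 :=
    NatTrans.congr_app (((Functor.whiskeringLeft E B (FamilyGroupoid M)).obj
      p.toFunctor).map_preimage α') e
  let d (b : B) : M (G.obj b).as ≃ M b := δ.app b
  refine ⟨fun b ↦ d b (G.obj b).pt, fun {b b'} f ↦ ?_, fun e ↦ ?_⟩
  · have h₁ : (G.map f).1.trans (d b') = (d b).trans (m f) := δ.naturality f
    have h₂ := (G.map f).2
    dsimp only
    rw [← h₂]
    exact (Equiv.congr_fun h₁ (G.obj b).pt).symm
  · have h₁ : d (p.toFunctor.obj e) = (α.hom.app e).1 := hδ e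
    dsimp only
    rw [h₁]
    exact (α.hom.app e).2

section

variable {E B : Cat.{u, u}} {p : E ⟶ B}

/-- Applied to the cospan of the identity of `e'` and the given vertical morphism. -/
lemma LiftsTo.symm {b : B} {e e' : E}
    (hp : (countableGenerators (injectiveOnObjects ⊓ groupoidalEquivalences)).rlp p)
    (h : LiftsTo p.toFunctor (𝟙 b) e e') : LiftsTo p.toFunctor (𝟙 b) e' e :=
  of_comp_right hp (by rw [Category.comp_id]; exact id h.obj_right) h

/-- The relation on the fiber of a functor given by the existence of a vertical morphism. -/
def verticalSetoid
    (hp : (countableGenerators (injectiveOnObjects ⊓ groupoidalEquivalences)).rlp p) (b : B) :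
    Setoid { e : E // p.toFunctor.obj e = b } where
  r e e' := LiftsTo p.toFunctor (𝟙 b) e.1 e'.1
  iseqv :=
    { refl e := LiftsTo.id e.2
      symm h := h.symm hp
      trans h h' := by simpa using h.comp h' }

variable (hp : (countableGenerators (injectiveOnObjects ⊓ groupoidalEquivalences)).rlp p)

/-- The set of classes of objects in a fiber up to vertical morphisms. -/
abbrev VerticalClass (b : B) : Type u := _root_.Quotient (verticalSetoid hp b)

/-- The class of an object in a fiber. -/
abbrev VerticalClass.mk {b : B} (e : E) (he : p.toFunctor.obj e = b) : VerticalClass hp b :=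
  Quotient.mk'' ⟨e, he⟩

/-- The relation between vertical classes given by the existence of morphisms over a given
morphism. -/
def VerticalClass.Related {b b' : B} (f : b ⟶ b') (x : VerticalClass hp b)
    (y : VerticalClass hp b') : Prop :=
  ∃ e e' he he', LiftsTo p.toFunctor f e e' ∧ x = .mk hp e he ∧ y = .mk hp e' he'

namespace VerticalClass

variable {hp} {b b' b'' : B} {f : b ⟶ b'}

lemma related_mk_iff {e e' : E} {he : p.toFunctor.obj e = b} {he' : p.toFunctor.obj e' = b'} :
    Related hp f (.mk hp e he) (.mk hp e' he') ↔ LiftsTo p.toFunctor f e e' := by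
  refine ⟨?_, fun h ↦ ⟨e, e', he, he', h, rfl, rfl⟩⟩
  rintro ⟨e₁, e₁', he₁, he₁', h, h₁, h₂⟩
  have h₁ : LiftsTo p.toFunctor (𝟙 b) e e₁ := Quotient.exact h₁
  have h₂ : LiftsTo p.toFunctor (𝟙 b') e' e₁' := Quotient.exact h₂
  simpa using (h₁.comp h).comp (h₂.symm hp)

lemma related_id (x : VerticalClass hp b) : Related hp (𝟙 b) x x := by
  obtain ⟨e, he⟩ := x
  exact related_mk_iff.2 (.id he)

lemma Related.comp {g : b' ⟶ b''} {x : VerticalClass hp b} {y : VerticalClass hp b'}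
    {z : VerticalClass hp b''} (h : Related hp f x y) (h' : Related hp g y z) :
    Related hp (f ≫ g) x z := by
  obtain ⟨e, he⟩ := x
  obtain ⟨e', he'⟩ := y
  obtain ⟨e'', he''⟩ := z
  exact related_mk_iff.2 ((related_mk_iff.1 h).comp (related_mk_iff.1 h'))

/-- Two lifts of `f` with the same source form a span over `f` and `f ≫ 𝟙`, which yields a vertical
morphism between their targets. -/
lemma existsUnique_right (f : b ⟶ b') (x : VerticalClass hp b) : ∃! y, Related hp f x y := by
  obtain ⟨e, he⟩ := x
  obtain ⟨e', h⟩ := LiftsTo.exists_of_source f hp he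
  refine ⟨.mk hp e' h.obj_right, related_mk_iff.2 h, ?_⟩
  rintro ⟨e'', he''⟩ h'
  have h' := related_mk_iff.1 h'
  exact Quotient.sound (LiftsTo.of_comp_left hp (by rwa [Category.comp_id]) h')

lemma existsUnique_left (f : b ⟶ b') (y : VerticalClass hp b') : ∃! x, Related hp f x y := by
  obtain ⟨e, he⟩ := y
  obtain ⟨e', h⟩ := LiftsTo.exists_of_target f hp he
  refine ⟨.mk hp e' h.obj_left, related_mk_iff.2 h, ?_⟩
  rintro ⟨e'', he''⟩ h'
  have h' := related_mk_iff.1 h'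
  exact Quotient.sound (LiftsTo.of_comp_right hp (by rwa [Category.id_comp]) h)

/-- The bijection between vertical classes over the endpoints of a morphism. -/
noncomputable def equiv (f : b ⟶ b') : VerticalClass hp b ≃ VerticalClass hp b' where
  toFun x := (existsUnique_right f x).choose
  invFun y := (existsUnique_left f y).choose
  left_inv x := (existsUnique_left f _).unique (existsUnique_left f _).choose_spec.1
    (existsUnique_right f x).choose_spec.1
  right_inv x := (existsUnique_right f _).unique (existsUnique_right f _).choose_spec.1
    (existsUnique_left f x).choose_spec.1

lemma equiv_eq_iff (x : VerticalClass hp b) (y : VerticalClass hp b') :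
    equiv f x = y ↔ Related hp f x y := by
  have h : Related hp f x (equiv f x) := (existsUnique_right f x).choose_spec.1
  exact ⟨fun h' ↦ by rwa [← h'], fun h' ↦ (existsUnique_right f x).unique h h'⟩

end VerticalClass

/-- The section `e ↦ [e]` extends to a section `t` over `B`. A representative of `t b` is an object
over `b`, and compatibility of `t` with a morphism between images of `e` and `e'` says that this
morphism lifts. -/
lemma surjectiveEquivalences_of_countableGenerators_rlp
    (hp : (countableGenerators (injectiveOnObjects ⊓ groupoidalEquivalences)).rlp p)
    (hp' : groupoidalEquivalences p) : surjectiveEquivalences p := by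
  obtain ⟨t, ht, ht'⟩ := exists_section_of_groupoidalEquivalences hp' (VerticalClass hp)
    VerticalClass.equiv
    (fun b ↦ Equiv.ext (fun x ↦ (VerticalClass.equiv_eq_iff _ _).2 (VerticalClass.related_id x)))
    (fun f g ↦ Equiv.ext (fun x ↦ (VerticalClass.equiv_eq_iff _ _).2
      (((VerticalClass.equiv_eq_iff x _).1 rfl).comp ((VerticalClass.equiv_eq_iff _ _).1 rfl))))
    (fun e ↦ .mk hp e rfl)
    (fun φ ↦ (VerticalClass.equiv_eq_iff _ _).2 (VerticalClass.related_mk_iff.2 (.map φ)))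
  refine ⟨fun b ↦ ?_, ⟨fun {e e'} β ↦ ?_⟩, faithful_of_countableGenerators_rlp hp hp'⟩
  · obtain ⟨e, he⟩ := t b
    exact ⟨e, he⟩
  · have := ht β
    rw [ht', ht', VerticalClass.equiv_eq_iff, VerticalClass.related_mk_iff] at this
    exact this.exists_map_eq

end

/-! ### The model structure -/

lemma surjectiveEquivalences_le_rlp : surjectiveEquivalences.{u} ≤ injectiveOnObjects.rlp :=
  fun _ _ _ hp _ _ _ hi ↦ hasLiftingProperty_of_surjectiveEquivalences hi hp

lemma injectiveOnObjects_rlp_le_countableGenerators_rlp (P : MorphismProperty Cat.{u, u}) :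
    P.rlp ≤ (countableGenerators P).rlp :=
  MorphismProperty.antitone_rlp (countableGenerators_le P)

instance : Countable IntervalCat.{u} := by
  have : Function.Surjective (fun b : Bool ↦ if b then IntervalCat.one.{u} else .zero) := by
    rintro (_ | _)
    exacts [⟨false, rfl⟩, ⟨true, rfl⟩]
  exact this.countable

instance {C : Type u} [Countable C] : Countable (Arrow (Discrete C)) :=
  have : Countable (Discrete C) := discreteEquiv.injective.countable
  countable_arrow

/-- Surjectivity on objects comes from lifting against the empty category in the point, fullness
from the two endpoints in the interval, faithfulness from a quotient of a countable category. -/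
lemma countableGenerators_injectiveOnObjects_rlp_le :
    (countableGenerators injectiveOnObjects.{u}).rlp ≤ surjectiveEquivalences := by
  intro E B p hp
  refine ⟨fun b ↦ ?_, ⟨fun {e e'} f ↦ ?_⟩,
    faithful_of_countableGenerators_injectiveOnObjects_rlp hp⟩
  · have hi : HasLiftingProperty (Functor.empty.{u} (Discrete PUnit.{u + 1})).toCatHom p :=
      have : Countable (Arrow (Cat.of (Discrete PEmpty.{u + 1}))) :=
        inferInstanceAs (Countable (Arrow (Discrete PEmpty.{u + 1})))
      have : Countable (Arrow (Cat.of (Discrete PUnit.{u + 1}))) :=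
        inferInstanceAs (Countable (Arrow (Discrete PUnit.{u + 1})))
      hasLiftingProperty_of_countable (fun x ↦ (Discrete.as x).elim) hp
    have sq : CommSq (Functor.empty.{u} E).toCatHom
        (Functor.empty.{u} (Discrete PUnit.{u + 1})).toCatHom p (Functor.fromPUnit b).toCatHom :=
      ⟨Cat.Hom.ext (Functor.empty_ext' _ _)⟩
    have : sq.HasLift := hi.sq_hasLift sq
    exact ⟨sq.lift.toFunctor.obj ⟨⟨⟩⟩,
      Functor.congr_obj (congr_arg Cat.Hom.toFunctor sq.fac_right) ⟨⟨⟩⟩⟩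
  · let i : Discrete (ULift.{u} Bool) ⥤ IntervalCat.{u} :=
      Discrete.functor (fun x ↦ if x.down then .one else .zero)
    have hi : HasLiftingProperty i.toCatHom p :=
      have : Countable (Arrow (Cat.of (Discrete (ULift.{u} Bool)))) :=
        inferInstanceAs (Countable (Arrow (Discrete (ULift.{u} Bool))))
      have : Countable (Arrow (Cat.of IntervalCat.{u})) :=
        inferInstanceAs (Countable (Arrow IntervalCat.{u}))
      hasLiftingProperty_of_countable (by
        rintro ⟨⟨_ | _⟩⟩ ⟨⟨_ | _⟩⟩ h
        · rfl
        · cases h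
        · cases h
        · rfl) hp
    let F : Discrete (ULift.{u} Bool) ⥤ E := Discrete.functor (fun x ↦ if x.down then e' else e)
    have sq : CommSq F.toCatHom i.toCatHom p (IntervalCat.functor f).toCatHom := ⟨by
      apply Cat.Hom.ext
      apply Discrete.functor_ext
      rintro ⟨_ | _⟩ <;> rfl⟩
    have : sq.HasLift := hi.sq_hasLift sq
    have h : LiftsTo p.toFunctor f e e' :=
      ⟨sq.lift.toFunctor.mapArrow.obj (Arrow.mk IntervalCat.arr),
        Functor.congr_obj (congr_arg Cat.Hom.toFunctor sq.fac_left) ⟨⟨false⟩⟩,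
        Functor.congr_obj (congr_arg Cat.Hom.toFunctor sq.fac_left) ⟨⟨true⟩⟩,
        congr_arg (fun (G : Cat.of IntervalCat ⟶ B) ↦
          G.toFunctor.mapArrow.obj (Arrow.mk IntervalCat.arr)) sq.fac_right⟩
    exact h.exists_map_eq

lemma countableGenerators_injectiveOnObjects_rlp :
    (countableGenerators injectiveOnObjects.{u}).rlp = surjectiveEquivalences :=
  le_antisymm countableGenerators_injectiveOnObjects_rlp_le
    (surjectiveEquivalences_le_rlp.trans (injectiveOnObjects_rlp_le_countableGenerators_rlp _))

lemma injectiveOnObjects_rlp : injectiveOnObjects.{u}.rlp = surjectiveEquivalences :=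
  le_antisymm ((injectiveOnObjects_rlp_le_countableGenerators_rlp _).trans
    countableGenerators_injectiveOnObjects_rlp_le) surjectiveEquivalences_le_rlp

lemma countableGenerators_rlp_llp_le :
    (countableGenerators (injectiveOnObjects.{u} ⊓ groupoidalEquivalences)).rlp.llp ≤
      injectiveOnObjects ⊓ groupoidalEquivalences := by
  intro A B i hi
  refine ⟨?_, groupoidalEquivalences_of_lifting i
    (fun Z _ ↦ hi _ (injectiveOnObjects_rlp_le_countableGenerators_rlp _ _ toPoint_mem_rlp))
    (fun Z _ ↦ hi _ (injectiveOnObjects_rlp_le_countableGenerators_rlp _ _ arrowEndpoints_mem_rlp))⟩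
  rw [← surjectiveEquivalences_llp]
  exact MorphismProperty.antitone_llp (surjectiveEquivalences_le_rlp.trans
    ((MorphismProperty.antitone_rlp inf_le_left).trans
      (injectiveOnObjects_rlp_le_countableGenerators_rlp _))) _ hi

/-- Retract argument: in the factorization of `i`, the second factor is a groupoidal equivalence by
two-out-of-three, hence a surjective equivalence, so `i` lifts against it. -/
lemma le_countableGenerators_rlp_llp :
    injectiveOnObjects.{u} ⊓ groupoidalEquivalences ≤
      (countableGenerators (injectiveOnObjects.{u} ⊓ groupoidalEquivalences)).rlp.llp := by
  intro A B i hi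
  let J := countableGenerators (injectiveOnObjects.{u} ⊓ groupoidalEquivalences)
  let d := MorphismProperty.factorizationData J.rlp.llp J.rlp i
  have hd : groupoidalEquivalences d.p :=
    groupoidalEquivalences.of_precomp d.i d.p (countableGenerators_rlp_llp_le _ d.hi).2
      (by rw [d.fac]; exact hi.2)
  have : HasLiftingProperty i d.p := hasLiftingProperty_of_surjectiveEquivalences hi.1
    (surjectiveEquivalences_of_countableGenerators_rlp d.hp hd)
  exact MorphismProperty.of_retract (RetractArrow.ofLeftLiftingProperty d.fac) d.hi

lemma countableGenerators_rlp_llp :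
    (countableGenerators (injectiveOnObjects.{u} ⊓ groupoidalEquivalences)).rlp.llp =
      injectiveOnObjects ⊓ groupoidalEquivalences :=
  le_antisymm countableGenerators_rlp_llp_le le_countableGenerators_rlp_llp

lemma countableGenerators_rlp :
    (countableGenerators (injectiveOnObjects.{u} ⊓ groupoidalEquivalences)).rlp =
      (injectiveOnObjects ⊓ groupoidalEquivalences).rlp := by
  rw [← MorphismProperty.rlp_llp_rlp, countableGenerators_rlp_llp]

lemma rlp_inf_groupoidalEquivalences :
    (injectiveOnObjects.{u} ⊓ groupoidalEquivalences).rlp ⊓ groupoidalEquivalences =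
      surjectiveEquivalences := by
  refine le_antisymm (fun _ _ p hp ↦ ?_) (le_inf (surjectiveEquivalences_le_rlp.trans
    (MorphismProperty.antitone_rlp inf_le_left)) surjectiveEquivalences_le_groupoidalEquivalences)
  exact surjectiveEquivalences_of_countableGenerators_rlp
    (injectiveOnObjects_rlp_le_countableGenerators_rlp _ _ hp.1) hp.2

instance : (injectiveOnObjects.{u}).IsWeakFactorizationSystem surjectiveEquivalences where
  rlp := injectiveOnObjects_rlp
  llp := surjectiveEquivalences_llp

instance : (injectiveOnObjects.{u} ⊓ groupoidalEquivalences).IsWeakFactorizationSystem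
    (injectiveOnObjects ⊓ groupoidalEquivalences).rlp where
  rlp := rfl
  llp := by rw [← countableGenerators_rlp, countableGenerators_rlp_llp]
  hasFactorization := by
    rw [← countableGenerators_rlp]
    -- Only the left class is rewritten; the same class also occurs inside the generators on the
    -- right.
    nth_rw 1 [← countableGenerators_rlp_llp]
    infer_instance

/-- The model structure on the category of small categories for which the cofibrations are the
functors which are injective on objects, and the weak equivalences are the groupoidal
equivalences. -/
abbrev groupoidalModelStructure : ModelCategory Cat.{u, u} :=
  let _ : CategoryWithCofibrations Cat.{u, u} := ⟨injectiveOnObjects⟩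
  let _ : CategoryWithWeakEquivalences Cat.{u, u} := ⟨groupoidalEquivalences⟩
  let _ : CategoryWithFibrations Cat.{u, u} :=
    ⟨(injectiveOnObjects ⊓ groupoidalEquivalences).rlp⟩
  have : (weakEquivalences Cat.{u, u}).HasTwoOutOfThreeProperty :=
    inferInstanceAs groupoidalEquivalences.HasTwoOutOfThreeProperty
  have : (cofibrations Cat.{u, u}).IsWeakFactorizationSystem (trivialFibrations Cat.{u, u}) := by
    change injectiveOnObjects.IsWeakFactorizationSystem
      ((injectiveOnObjects.{u} ⊓ groupoidalEquivalences).rlp ⊓ groupoidalEquivalences)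
    rw [rlp_inf_groupoidalEquivalences]
    infer_instance
  have : (trivialCofibrations Cat.{u, u}).IsWeakFactorizationSystem (fibrations Cat.{u, u}) :=
    inferInstanceAs ((injectiveOnObjects.{u} ⊓ groupoidalEquivalences).IsWeakFactorizationSystem
      (injectiveOnObjects ⊓ groupoidalEquivalences).rlp)
  ModelCategory.mk' Cat.{u, u}

/-! ### Fibrant objects -/

lemma localization_mem (C : Type u) [Category.{u} C] :
    (injectiveOnObjects.{u} ⊓ groupoidalEquivalences)
      (⊤ : MorphismProperty C).Q.toCatHom := by
  refine ⟨(Localization.Construction.objEquiv (⊤ : MorphismProperty C)).injective, fun Z _ ↦ ?_⟩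
  exact
    { full := Localization.full_whiskeringLeft (⊤ : MorphismProperty C).Q ⊤ Z
      faithful := Localization.faithful_whiskeringLeft (⊤ : MorphismProperty C).Q ⊤ Z
      essSurj := ⟨fun K ↦ ⟨Localization.Construction.lift K (fun _ _ _ _ ↦ inferInstance),
        ⟨eqToIso (Localization.Construction.fac K _)⟩⟩⟩ }

/-- Extending the identity of `C` along the localization at all morphisms gives a retraction, and it
sends inverted morphisms to isomorphisms of `C`. -/
lemma toPoint_mem_rlp_iff (C : Cat.{u, u}) :
    (injectiveOnObjects.{u} ⊓ groupoidalEquivalences).rlp (toPoint C) ↔ IsGroupoid C := by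
  refine ⟨fun h ↦ ?_, fun h ↦ ?_⟩
  · have hi := h _ (localization_mem C)
    have sq : CommSq (𝟙 C) (⊤ : MorphismProperty C).Q.toCatHom (toPoint C) (toPoint _) :=
      ⟨Cat.Hom.ext (Functor.punit_ext' _ _)⟩
    have : sq.HasLift := hi.sq_hasLift sq
    have hl : (⊤ : MorphismProperty C).Q ⋙ sq.lift.toFunctor = 𝟭 C :=
      congr_arg Cat.Hom.toFunctor sq.fac_left
    refine ⟨fun {x y} f ↦ ?_⟩
    have hf : IsIso ((⊤ : MorphismProperty C).Q.map f) :=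
      Localization.inverts (⊤ : MorphismProperty C).Q ⊤ f trivial
    have : IsIso ((𝟭 C).map f) := by
      rw [← hl]
      exact @Functor.map_isIso _ _ _ _ _ _ sq.lift.toFunctor _ hf
    exact this
  · let _ : Groupoid C := Groupoid.ofIsGroupoid
    exact toPoint_mem_rlp (Z := C)

theorem mainTheorem10 :
    ∃ _ : ModelCategory Cat.{u, u},
      IsCombinatorialModelCategory.{u} Cat.{u, u} ∧
      cofibrations Cat.{u, u} = injectiveOnObjects.{u} ∧
      weakEquivalences Cat.{u, u} = groupoidalEquivalences.{u} ∧
      fibrations Cat.{u, u} = (injectiveOnObjects.{u} ⊓ groupoidalEquivalences.{u}).rlp ∧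
      ∀ C : Cat.{u, u}, IsFibrant C ↔ IsGroupoid C := by
  let _ : ModelCategory Cat.{u, u} := groupoidalModelStructure
  refine ⟨groupoidalModelStructure,
    { isLocallyPresentable := isLocallyPresentable_cat
      exists_generatingCofibrations := ⟨countableGenerators injectiveOnObjects, inferInstance, ?_⟩
      exists_generatingTrivialCofibrations :=
        ⟨countableGenerators (injectiveOnObjects ⊓ groupoidalEquivalences), inferInstance, ?_⟩ },
    rfl, rfl, rfl, fun C ↦ ?_⟩
  · exact rlp_inf_groupoidalEquivalences.trans countableGenerators_injectiveOnObjects_rlp.symm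
  · exact countableGenerators_rlp.symm
  · rw [isFibrant_iff, fibration_iff, ← toPoint_mem_rlp_iff]
    exact MorphismProperty.arrow_mk_iso_iff (injectiveOnObjects ⊓ groupoidalEquivalences).rlp
      (Arrow.isoMk (Iso.refl C) (terminalIsTerminal.uniqueUpToIso Cat.isTerminalDiscretePUnit)
        (Cat.isTerminalDiscretePUnit.hom_ext _ _))
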